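/- Let $\tau$ be a finite relational vocabulary. All formulae are in negation normal form, i.e. built from literals $R\bar x$, $\neg R\bar x$, $x=y$, $x\neq y$ by $\land,\lor,\exists,\forall$; these are the formulae of $\mathrm{FO}(\tau)$. **Semantics.** A *lattice semiring* is the commutative semiring $(K,+,\cdot,0,1)=(K,\sqcup,\sqcap,\bot,\top)$ of a bounded distributive lattice $K$ with $0\neq 1$. A *$K$-interpretation* over a finite non-empty universe $A$ is a map $\pi$ assigning a value in $K$ to every instantiated literal $R\bar a$, $\neg R\bar a$ ($R\in\tau$, $\bar a\subseteq A$). It is *model-defining* if for all $R,\bar a$ precisely one of $\pi(R\bar a)$, $\pi(\neg R\bar a)$ is $0$, and it *tracks only positive information* if $\pi(\neg R\bar a)\in\{0,1\}$ for all $R,\bar a$. It extends to formulae by giving (in)equalities their truth value in $\{0,1\}$ and interpreting $\lor,\exists$ as sums and $\land,\forall$ as products (over $A$). The Gaifman graph of $\pi$ has vertex set $A$, with $a\ne b$ adjacent iff both occur in some tuple $\bar c$ with $\pi(R\bar c)\neq 0$ for some $R\in\tau$; $d$ is its distance and $B_r(a)=\{b : d(a,b)\le r\}$. Besides the usual quantifiers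 we use ball quantifiers $\exists y\in B_r(x)$, $\forall y\in B_r(x)$, interpreted as the sum, respectively the product, over $y\in B_r(x)$. Two sentences $\psi,\varphi$ are *lattice-equivalent* if $\pi[\![\psi]\!]=\pi[\![\varphi]\!]$ for every lattice semiring $K$ and every model-defining $K$-interpretation $\pi$ over a finite non-empty universe that tracks only positive information. **Local sentences.** An *$r$-local formula* $\varphi^{(r)}(\bar x)$ is built from literals by $\land$, $\lor$ and ball quantifiers such that for every bound variable $z$, the radii along the chain of ball quantifiers leading from $z$ to a free variable sum up to at most $r$. Distance formulae abbreviate: $d(x,y)\le r$ for $\exists x'\in B_r(x)\,(x'=y)$, and $d(x,y)>r$ for $\forall x'\in B_r(x)\,(x'\ne y)$. A *basic local sentence* is a sentence of one of the forms $$\exists y_1\dots\exists y_m\Big(\bigwedge_{i<j} d(y_i,y_j)>2r\ \land\ \bigwedge_{i\le m}\varphi^{(r)}(y_i)\Big),\qquad \forall y_1\dots\forall y_m\Big(\bigvee_{i<j} d(y_i,y_j)\le 2r\ \lor\ \bigvee_{i\le m}\varphi^{(r)}(y_i)\Big)$$ with $m\ge 1$, $r\in\mathbb N$ and an $r$-local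 formula $\varphi^{(r)}(y)$ in one free variable. A *local sentence* is a positive Boolean combination (using $\land,\lor$) of basic local sentences. **Theorem.** For every $\mathrm{FO}(\tau)$-sentence $\psi$ there is a local sentence $\varphi$ that is lattice-equivalent to $\psi$. -/

import Mathlib

universe u v w z

namespace SemiringLogic

/-! ### Syntax: formulae in negation normal form, with ball quantifiers -/

/-- Formulae over the relational vocabulary `τ`, in negation normal form, with free variables
`x₀, …, x₍ₙ₋₁₎` indexed by `Fin n`.  A quantifier binds the variable with the largest index of its
scope.  Besides the first-order constructors there are the ball quantifiers
`bex r i φ`, i.e. `∃ y ∈ B_r(x_i), φ`, and `ball r i φ`, i.e. `∀ y ∈ B_r(x_i), φ`. -/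
inductive Formula (τ : FirstOrder.Language) : ℕ → Type _
  | rel {n k : ℕ} (R : τ.Relations k) (v : Fin k → Fin n) : Formula τ n
  | nrel {n k : ℕ} (R : τ.Relations k) (v : Fin k → Fin n) : Formula τ n
  | eq {n : ℕ} (i j : Fin n) : Formula τ n
  | neq {n : ℕ} (i j : Fin n) : Formula τ n
  | and {n : ℕ} (φ ψ : Formula τ n) : Formula τ n
  | or {n : ℕ} (φ ψ : Formula τ n) : Formula τ n
  | ex {n : ℕ} (φ : Formula τ (n + 1)) : Formula τ n
  | all {n : ℕ} (φ : Formula τ (n + 1)) : Formula τ n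
  | bex {n : ℕ} (r : ℕ) (i : Fin n) (φ : Formula τ (n + 1)) : Formula τ n
  | ball {n : ℕ} (r : ℕ) (i : Fin n) (φ : Formula τ (n + 1)) : Formula τ n

/-- Sentences: formulae without free variables. -/
abbrev Sentence (τ : FirstOrder.Language) := Formula τ 0

namespace Formula

/-- Plain first-order formulae `FO(τ)`: those without ball quantifiers. -/
def IsFO {τ : FirstOrder.Language} : {n : ℕ} → Formula τ n → Prop
  | _, rel _ _ => True
  | _, nrel _ _ => True
  | _, eq _ _ => True
  | _, neq _ _ => True
  | _, and φ ψ => φ.IsFO ∧ ψ.IsFO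
  | _, or φ ψ => φ.IsFO ∧ ψ.IsFO
  | _, ex φ => φ.IsFO
  | _, all φ => φ.IsFO
  | _, bex _ _ _ => False
  | _, ball _ _ _ => False

/-- Renaming of the free variables along `f`. -/
def rename {τ : FirstOrder.Language} : {n m : ℕ} → (Fin n → Fin m) → Formula τ n → Formula τ m
  | _, _, f, rel R v => rel R (f ∘ v)
  | _, _, f, nrel R v => nrel R (f ∘ v)
  | _, _, f, eq i j => eq (f i) (f j)
  | _, _, f, neq i j => neq (f i) (f j)
  | _, _, f, and φ ψ => and (φ.rename f) (ψ.rename f)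
  | _, _, f, or φ ψ => or (φ.rename f) (ψ.rename f)
  | _, m, f, ex φ => ex (φ.rename (Fin.snoc (fun i => (f i).castSucc) (Fin.last m)))
  | _, m, f, all φ => all (φ.rename (Fin.snoc (fun i => (f i).castSucc) (Fin.last m)))
  | _, m, f, bex r i φ =>
      bex r (f i) (φ.rename (Fin.snoc (fun i => (f i).castSucc) (Fin.last m)))
  | _, m, f, ball r i φ =>
      ball r (f i) (φ.rename (Fin.snoc (fun i => (f i).castSucc) (Fin.last m)))

/-- `φ.LocalFrom r δ`: `φ` is built from literals by conjunctions, disjunctions and ball quantifiers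
only, and all paths in its quantification dag have total length at most `r`, when the variable `x_i`
that is free in `φ` is already connected to a root by a path of length `δ i`.  A quantifier
`Q z ∈ B_s(x_i)` contributes the edge `z → x_i` of length `s`, so that the path
from `z` has length `δ i + s`. -/
def LocalFrom {τ : FirstOrder.Language} (r : ℕ) : {n : ℕ} → (Fin n → ℕ) → Formula τ n → Prop
  | _, _, rel _ _ => True
  | _, _, nrel _ _ => True
  | _, _, eq _ _ => True
  | _, _, neq _ _ => True
  | _, δ, and φ ψ => φ.LocalFrom r δ ∧ ψ.LocalFrom r δ
  | _, δ, or φ ψ => φ.LocalFrom r δ ∧ ψ.LocalFrom r δ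
  | _, _, ex _ => False
  | _, _, all _ => False
  | _, δ, bex s i φ => δ i + s ≤ r ∧ φ.LocalFrom r (Fin.snoc δ (δ i + s))
  | _, δ, ball s i φ => δ i + s ≤ r ∧ φ.LocalFrom r (Fin.snoc δ (δ i + s))

/-- `φ` is an `r`-local formula around its free variables. -/
def IsLocal {τ : FirstOrder.Language} (r : ℕ) {n : ℕ} (φ : Formula τ n) : Prop :=
  φ.LocalFrom r (fun _ => 0)

/-- The distance formula `d(x_i, x_j) ≤ r`, as `∃ y ∈ B_r(x_i), y = x_j`. -/
def distLE {τ : FirstOrder.Language} {n : ℕ} (r : ℕ) (i j : Fin n) : Formula τ n :=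
  bex r i (eq (Fin.last n) j.castSucc)

/-- The distance formula `d(x_i, x_j) > r`, as `∀ y ∈ B_r(x_i), y ≠ x_j`. -/
def distGT {τ : FirstOrder.Language} {n : ℕ} (r : ℕ) (i j : Fin n) : Formula τ n :=
  ball r i (neq (Fin.last n) j.castSucc)

/-- The list of all pairs `(i, j)` with `i < j`. -/
def pairs (m : ℕ) : List (Fin m × Fin m) :=
  (List.product (List.finRange m) (List.finRange m)).filter (fun p => p.1 < p.2)

/-- The conjunction `φ 0 ∧ (φ 1 ∧ ⋯ ∧ φ m)`. -/
def conj {τ : FirstOrder.Language} {n : ℕ} : (m : ℕ) → (Fin (m + 1) → Formula τ n) → Formula τ n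
  | 0, φ => φ 0
  | m + 1, φ => and (φ 0) (conj m (fun i => φ i.succ))

/-- The disjunction `φ 0 ∨ (φ 1 ∨ ⋯ ∨ φ m)`. -/
def disj {τ : FirstOrder.Language} {n : ℕ} : (m : ℕ) → (Fin (m + 1) → Formula τ n) → Formula τ n
  | 0, φ => φ 0
  | m + 1, φ => or (φ 0) (disj m (fun i => φ i.succ))

/-- `∃ x₀ ⋯ ∃ x₍ₘ₋₁₎, φ`. -/
def exs {τ : FirstOrder.Language} : {m : ℕ} → Formula τ m → Sentence τ
  | 0, φ => φ
  | _ + 1, φ => exs (ex φ)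

/-- `∀ x₀ ⋯ ∀ x₍ₘ₋₁₎, φ`. -/
def alls {τ : FirstOrder.Language} : {m : ℕ} → Formula τ m → Sentence τ
  | 0, φ => φ
  | _ + 1, φ => alls (all φ)

/-- The scattered quantification `∃ y₁ ⋯ ∃ yₘ (⋀_{i<j} d(yᵢ, yⱼ) > 2r ∧ θ)`. -/
def exScattered {τ : FirstOrder.Language} {m : ℕ} (r : ℕ) (θ : Formula τ m) : Sentence τ :=
  exs ((pairs m).foldr (fun p χ => and (distGT (2 * r) p.1 p.2) χ) θ)

/-- The scattered quantification `∀ y₁ ⋯ ∀ yₘ (⋁_{i<j} d(yᵢ, yⱼ) ≤ 2r ∨ θ)`. -/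
def allScattered {τ : FirstOrder.Language} {m : ℕ} (r : ℕ) (θ : Formula τ m) : Sentence τ :=
  alls ((pairs m).foldr (fun p χ => or (distLE (2 * r) p.1 p.2) χ) θ)

/-- Basic local sentences: scattered quantification of `m + 1 ≥ 1` elements over the conjunction
(existential case) or the disjunction (universal case) of the instances `φ(yᵢ)` of one and the same
`r`-local formula `φ` in one variable. -/
inductive IsBasicLocal {τ : FirstOrder.Language} : Sentence τ → Prop
  | ex (r m : ℕ) (φ : Formula τ 1) (hφ : φ.IsLocal r) :
      IsBasicLocal (exScattered r (conj m (fun i => φ.rename (fun _ => i))))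
  | all (r m : ℕ) (φ : Formula τ 1) (hφ : φ.IsLocal r) :
      IsBasicLocal (allScattered r (disj m (fun i => φ.rename (fun _ => i))))

/-- Local sentences: positive Boolean combinations of basic local sentences. -/
inductive IsLocalSentence {τ : FirstOrder.Language} : Sentence τ → Prop
  | basic {φ : Sentence τ} (h : φ.IsBasicLocal) : IsLocalSentence φ
  | and {φ ψ : Sentence τ} (hφ : IsLocalSentence φ) (hψ : IsLocalSentence ψ) :
      IsLocalSentence (φ.and ψ)
  | or {φ ψ : Sentence τ} (hφ : IsLocalSentence φ) (hψ : IsLocalSentence ψ) :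
      IsLocalSentence (φ.or ψ)

end Formula

/-! ### Semiring semantics -/

/-- Instantiated `τ`-literals `R a` and `¬ R a` over the universe `A`. -/
inductive Literal (τ : FirstOrder.Language) (A : Type*)
  | pos {k : ℕ} (R : τ.Relations k) (a : Fin k → A) : Literal τ A
  | neg {k : ℕ} (R : τ.Relations k) (a : Fin k → A) : Literal τ A

/-- `K`-interpretations of vocabulary `τ` and universe `A`. -/
abbrev Interpretation (τ : FirstOrder.Language) (A K : Type*) := Literal τ A → K

namespace Interpretation

/-- Of any two complementary literals precisely one has the value `0`. -/
def ModelDefining {τ : FirstOrder.Language} {A K : Type*} [CommSemiring K]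
    (π : Interpretation τ A K) : Prop :=
  ∀ (k : ℕ) (R : τ.Relations k) (a : Fin k → A), Xor (π (.pos R a) = 0) (π (.neg R a) = 0)

/-- Only positive information is tracked: negative literals have value `0` or `1`. -/
def TracksPositive {τ : FirstOrder.Language} {A K : Type*} [CommSemiring K]
    (π : Interpretation τ A K) : Prop :=
  ∀ (k : ℕ) (R : τ.Relations k) (a : Fin k → A), π (.neg R a) = 0 ∨ π (.neg R a) = 1

/-- The Gaifman graph: distinct elements are adjacent iff they occur together in a positive
literal of non-zero value. -/
def gaifmanGraph {τ : FirstOrder.Language} {A K : Type*} [CommSemiring K]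
    (π : Interpretation τ A K) : SimpleGraph A where
  Adj a b := a ≠ b ∧ ∃ (k : ℕ) (R : τ.Relations k) (c : Fin k → A),
    π (.pos R c) ≠ 0 ∧ a ∈ Set.range c ∧ b ∈ Set.range c
  symm := ⟨fun _ _ ⟨hne, k, R, c, h, ha, hb⟩ => ⟨hne.symm, k, R, c, h, hb, ha⟩⟩
  loopless := ⟨fun _ h => h.1 rfl⟩

open Classical in
/-- The `r`-neighbourhood of `a`: all elements at distance at most `r` in the Gaifman graph
(elements of other components are at distance `⊤`). -/
noncomputable def nbhd {τ : FirstOrder.Language} {A K : Type*} [CommSemiring K] [Fintype A]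
    (π : Interpretation τ A K) (r : ℕ) (a : A) : Finset A :=
  Finset.univ.filter (fun b => π.gaifmanGraph.edist a b ≤ (r : ℕ∞))

open Classical in
/-- The value `π⟦φ(a)⟧` of a formula in a `K`-interpretation. -/
noncomputable def eval {τ : FirstOrder.Language} {A K : Type*} [CommSemiring K] [Fintype A]
    (π : Interpretation τ A K) : {n : ℕ} → Formula τ n → (Fin n → A) → K
  | _, .rel R v, a => π (.pos R (a ∘ v))
  | _, .nrel R v, a => π (.neg R (a ∘ v))
  | _, .eq i j, a => if a i = a j then 1 else 0
  | _, .neq i j, a => if a i = a j then 0 else 1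
  | _, .and φ ψ, a => π.eval φ a * π.eval ψ a
  | _, .or φ ψ, a => π.eval φ a + π.eval ψ a
  | _, .ex φ, a => ∑ b : A, π.eval φ (Fin.snoc a b)
  | _, .all φ, a => ∏ b : A, π.eval φ (Fin.snoc a b)
  | _, .bex r i φ, a => ∑ b ∈ π.nbhd r (a i), π.eval φ (Fin.snoc a b)
  | _, .ball r i φ, a => ∏ b ∈ π.nbhd r (a i), π.eval φ (Fin.snoc a b)

end Interpretation

/-- `K`-equivalence: equal values in all model-defining `K`-interpretations that track only
positive information, over all finite (non-empty) universes, for all tuples. -/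
def KEquiv {τ : FirstOrder.Language.{u, v}} (K : Type w) [CommSemiring K] {n : ℕ}
    (φ ψ : Formula τ n) : Prop :=
  ∀ (A : Type z) [Fintype A] [Nonempty A] (π : Interpretation τ A K),
    π.ModelDefining → π.TracksPositive → ∀ a : Fin n → A, π.eval φ a = π.eval ψ a

/-- The lattice semiring `(K, ⊔, ⊓, ⊥, ⊤)` of a bounded distributive lattice. -/
@[reducible]
def latticeSemiring (K : Type*) [DistribLattice K] [BoundedOrder K] : CommSemiring K where
  add := (· ⊔ ·)
  zero := ⊥
  mul := (· ⊓ ·)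
  one := ⊤
  add_assoc := sup_assoc
  zero_add := bot_sup_eq
  add_zero := sup_bot_eq
  add_comm := sup_comm
  mul_assoc := inf_assoc
  one_mul := top_inf_eq
  mul_one := inf_top_eq
  mul_comm := inf_comm
  zero_mul := bot_inf_eq
  mul_zero := inf_bot_eq
  left_distrib := inf_sup_left
  right_distrib := inf_sup_right
  nsmul := @nsmulRec K ⟨⊥⟩ ⟨(· ⊔ ·)⟩

/-- Lattice-equivalence: `K`-equivalence for all lattice semirings `K` (with `0 ≠ 1`). -/
def LatticeEquiv {τ : FirstOrder.Language.{u, v}} {n : ℕ} (φ ψ : Formula τ n) : Prop :=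
  ∀ (K : Type w) [DistribLattice K] [BoundedOrder K] [Nontrivial K],
    letI : CommSemiring K := latticeSemiring K
    KEquiv.{u, v, w, z} K φ ψ

end SemiringLogic

/-! Prime ideals separate the points of a distributive lattice. Being outside a prime ideal `J`
commutes with finite sums and products, so it turns an interpretation into a two-valued structure in
which `R` and `¬R` are independent. As negative literals only take the values 0 and 1, one that
fails has a non-zero positive counterpart. Hence literals that are positive and hold, or negative
and fail, live on cliques of the Gaifman graph, which does not depend on `J`. It remains to prove a
Gaifman theorem for such structures (`exists_isLocalSentence_holds_iff`).

Without negation, back-and-forth equivalence becomes the preorder `Sim`: literals pass from left to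
right only, while equalities and moves are two-way. Dual structures reverse `Sim` and exchange the
roles of existential and universal quantifiers. First-order formulae are preserved if finite
families of `A` can be mirrored in `B` (`ExSim`) and conversely (`AllSim`). The hard step is to
answer an element `a` by some `b` so that both conditions survive, because the two mirrorings are
unrelated to each other. `exists_rematch` reconciles them on the rare elements of `B` by alternating
paths, as in the Cantor–Bernstein theorem. `exists_mirror` handles the remaining elements, whose
local types have many scattered counterparts in `A`.

For sentences, `ExSim` and `AllSim` follow from preservation of finitely many basic local sentences.
These use one formula for all scattered elements; Hall's theorem (`ScatSim.exists_sdr`) recovers an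
elementwise correspondence. -/

namespace SemiringLogic

/-! ### Structures with independent positive and negative literals -/

/-- A structure in which positive and negative literals are interpreted independently of each other,
together with a graph such that positive literals hold, and negative literals fail, only on
cliques. -/
structure LitStructure (τ : FirstOrder.Language.{u, v}) where
  carrier : Type z
  nonempty : Nonempty carrier
  graph : SimpleGraph carrier
  holds : Literal τ carrier → Prop
  pos_clique : ∀ {k : ℕ} (R : τ.Relations k) (a : Fin k → carrier), holds (.pos R a) →
    ∀ i j, graph.Adj (a i) (a j) ∨ a i = a j
  neg_clique : ∀ {k : ℕ} (R : τ.Relations k) (a : Fin k → carrier), ¬ holds (.neg R a) →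
    ∀ i j, graph.Adj (a i) (a j) ∨ a i = a j

namespace LitStructure

variable {τ : FirstOrder.Language.{u, v}}

instance : CoeSort (LitStructure.{u, v, z} τ) (Type z) := ⟨carrier⟩

instance (A : LitStructure.{u, v, z} τ) : Nonempty A := A.nonempty

/-- The dual structure, in which complementary literals are interchanged and negated. -/
def dual (A : LitStructure.{u, v, z} τ) : LitStructure.{u, v, z} τ where
  carrier := A.carrier
  nonempty := A.nonempty
  graph := A.graph
  holds
    | .pos R a => ¬ A.holds (.neg R a)
    | .neg R a => ¬ A.holds (.pos R a)
  pos_clique R a h := A.neg_clique R a h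
  neg_clique R a h := A.pos_clique R a (not_not.1 h)

/-- The elements `a` and `b` have distance at most `r`. -/
def Near (A : LitStructure.{u, v, z} τ) (r : ℕ) (a b : A) : Prop := A.graph.edist a b ≤ r

variable {A B C : LitStructure.{u, v, z} τ}

theorem Near.refl (r : ℕ) (a : A) : A.Near r a a := by simp [Near]

theorem Near.symm {r : ℕ} {a b : A} (h : A.Near r a b) : A.Near r b a := by
  unfold Near at *; rwa [SimpleGraph.edist_comm]

theorem Near.mono {r s : ℕ} (hrs : r ≤ s) {a b : A} (h : A.Near r a b) : A.Near s a b :=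
  h.trans (by exact_mod_cast hrs)

theorem Near.trans {r s : ℕ} {a b c : A} (h : A.Near r a b) (h' : A.Near s b c) :
    A.Near (r + s) a c := by
  unfold Near at *
  push_cast
  exact SimpleGraph.edist_triangle.trans (add_le_add h h')

/-- Triangle inequality with an explicit bound. -/
theorem Near.trans' {r s t : ℕ} {a b c : A} (h : A.Near r a b) (h' : A.Near s b c)
    (ht : r + s ≤ t) : A.Near t a c := (h.trans h').mono ht

theorem near_zero {a b : A} : A.Near 0 a b ↔ a = b := by simp [Near]

theorem near_one {a b : A} : A.Near 1 a b ↔ A.graph.Adj a b ∨ a = b := by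
  simp [Near, SimpleGraph.edist_le_one_iff_adj_or_eq]

theorem near_succ {r : ℕ} {a b : A} : A.Near (r + 1) a b ↔ ∃ c, A.Near r a c ∧ A.Near 1 c b := by
  constructor
  · intro h
    obtain ⟨p, hp⟩ := SimpleGraph.exists_walk_of_edist_ne_top
      (ne_top_of_le_ne_top (ENat.natCast_ne_top _) h)
    have hl : p.length ≤ r + 1 := by
      have : (p.length : ℕ∞) ≤ ((r + 1 : ℕ) : ℕ∞) := hp ▸ h
      exact_mod_cast this
    clear h hp
    induction p generalizing r with
    | nil => exact ⟨_, Near.refl _ _, Near.refl _ _⟩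
    | @cons a c b hac p ih =>
      simp only [SimpleGraph.Walk.length_cons, add_le_add_iff_right] at hl
      cases r with
      | zero =>
        have : c = b := SimpleGraph.Walk.eq_of_length_eq_zero (p := p) (by omega)
        exact ⟨a, Near.refl _ _, near_one.2 (Or.inl (this ▸ hac))⟩
      | succ r =>
        obtain ⟨d, hd, hdb⟩ := ih hl
        exact ⟨d, (near_one.2 (Or.inl hac)).trans' hd (by omega), hdb⟩
  · rintro ⟨c, h, h'⟩
    exact h.trans h'

end LitStructure

open LitStructure

variable {τ : FirstOrder.Language.{u, v}} {A B C : LitStructure.{u, v, z} τ}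

/-- Extension of a family by one more element. -/
def optCons {ι : Type} {X : Type*} (a : X) (α : ι → X) : Option ι → X
  | none => a
  | some i => α i

@[simp] theorem optCons_none {ι : Type} {X : Type*} (a : X) (α : ι → X) : optCons a α none = a := rfl

@[simp] theorem optCons_some {ι : Type} {X : Type*} (a : X) (α : ι → X) (i : ι) :
    optCons a α (some i) = α i := rfl

theorem optCons_comp {ι κ : Type} {X : Type*} (a : X) (α : ι → X) (f : κ → ι) :
    optCons a (α ∘ f) = optCons a α ∘ Option.map f := by
  funext o; cases o <;> rfl

/-- All literals true of `α` are true of `β`, and equalities agree. -/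
def SimZero {ι : Type} (α : ι → A) (β : ι → B) : Prop :=
  (∀ (l : ℕ) (R : τ.Relations l) (t : Fin l → ι),
    (A.holds (.pos R (α ∘ t)) → B.holds (.pos R (β ∘ t))) ∧
    (A.holds (.neg R (α ∘ t)) → B.holds (.neg R (β ∘ t)))) ∧
  ∀ i j, α i = α j ↔ β i = β j

/-- One-directional local back-and-forth relation: literals are preserved from `A` to `B`, during
`k` rounds in which elements at distance at most `1` from the present ones are added. -/
def Sim : ℕ → {ι : Type} → (ι → A) → (ι → B) → Prop
  | 0, _, α, β => SimZero α β
  | k + 1, _, α, β => Sim k α β ∧ ∀ i,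
      (∀ a, A.Near 1 (α i) a → ∃ b, B.Near 1 (β i) b ∧ Sim k (optCons a α) (optCons b β)) ∧
      (∀ b, B.Near 1 (β i) b → ∃ a, A.Near 1 (α i) a ∧ Sim k (optCons a α) (optCons b β))

/-! ### Calculus of the local back-and-forth preorder -/

namespace Sim

theorem mono {k k' : ℕ} (hk : k ≤ k') {ι : Type} {α : ι → A} {β : ι → B} (h : Sim k' α β) :
    Sim k α β := by
  induction hk with
  | refl => exact h
  | step _ ih => exact ih h.1

theorem zero {k : ℕ} {ι : Type} {α : ι → A} {β : ι → B} (h : Sim k α β) : SimZero α β :=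
  h.mono (Nat.zero_le k)

theorem reindex {k : ℕ} {ι κ : Type} {α : ι → A} {β : ι → B} (h : Sim k α β) (f : κ → ι) :
    Sim k (α ∘ f) (β ∘ f) := by
  induction k generalizing ι κ with
  | zero => exact ⟨fun l R t => h.1 l R (f ∘ t), fun i j => h.2 (f i) (f j)⟩
  | succ k ih =>
    refine ⟨ih h.1 f, fun i => ⟨fun a ha => ?_, fun b hb => ?_⟩⟩
    · obtain ⟨b, hb, hs⟩ := (h.2 (f i)).1 a ha
      exact ⟨b, hb, by simpa only [optCons_comp] using ih hs (Option.map f)⟩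
    · obtain ⟨a, ha, hs⟩ := (h.2 (f i)).2 b hb
      exact ⟨a, ha, by simpa only [optCons_comp] using ih hs (Option.map f)⟩

/-- Reindexing, with the resulting families given up to pointwise equality. -/
theorem reindex' {k : ℕ} {ι κ : Type} {α : ι → A} {β : ι → B} (h : Sim k α β) (f : κ → ι)
    {α' : κ → A} {β' : κ → B} (hα : ∀ x, α' x = α (f x)) (hβ : ∀ x, β' x = β (f x)) :
    Sim k α' β' := by
  obtain rfl : α' = α ∘ f := funext hα
  obtain rfl : β' = β ∘ f := funext hβ
  exact h.reindex f

theorem refl (k : ℕ) {ι : Type} (α : ι → A) : Sim k α α := by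
  induction k generalizing ι with
  | zero => exact ⟨fun _ _ _ => ⟨id, id⟩, fun _ _ => Iff.rfl⟩
  | succ k ih => exact ⟨ih α, fun i => ⟨fun a ha => ⟨a, ha, ih _⟩, fun a ha => ⟨a, ha, ih _⟩⟩⟩

theorem trans {k : ℕ} {ι : Type} {α : ι → A} {β : ι → B} {γ : ι → C} (h : Sim k α β)
    (h' : Sim k β γ) : Sim k α γ := by
  induction k generalizing ι with
  | zero =>
    exact ⟨fun l R t => ⟨fun x => (h'.1 l R t).1 ((h.1 l R t).1 x),
      fun x => (h'.1 l R t).2 ((h.1 l R t).2 x)⟩, fun i j => (h.2 i j).trans (h'.2 i j)⟩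
  | succ k ih =>
    refine ⟨ih h.1 h'.1, fun i => ⟨fun a ha => ?_, fun c hc => ?_⟩⟩
    · obtain ⟨b, hb, hs⟩ := (h.2 i).1 a ha
      obtain ⟨c, hc, hs'⟩ := (h'.2 i).1 b hb
      exact ⟨c, hc, ih hs hs'⟩
    · obtain ⟨b, hb, hs'⟩ := (h'.2 i).2 c hc
      obtain ⟨a, ha, hs⟩ := (h.2 i).2 b hb
      exact ⟨a, ha, ih hs hs'⟩

theorem dual {k : ℕ} {ι : Type} {α : ι → A} {β : ι → B} (h : Sim k α β) :
    Sim (A := B.dual) (B := A.dual) k β α := by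
  induction k generalizing ι with
  | zero =>
    exact ⟨fun l R t => ⟨fun x y => x ((h.1 l R t).2 y), fun x y => x ((h.1 l R t).1 y)⟩,
      fun i j => (h.2 i j).symm⟩
  | succ k ih =>
    refine ⟨ih h.1, fun i => ⟨fun b hb => ?_, fun a ha => ?_⟩⟩
    · obtain ⟨a, ha, hs⟩ := (h.2 i).2 b hb
      exact ⟨a, ha, ih hs⟩
    · obtain ⟨b, hb, hs⟩ := (h.2 i).1 a ha
      exact ⟨b, hb, ih hs⟩

theorem of_dual {k : ℕ} {ι : Type} {α : ι → A} {β : ι → B}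
    (h : Sim (A := B.dual) (B := A.dual) k β α) : Sim k α β := by
  induction k generalizing ι with
  | zero =>
    exact ⟨fun l R t => ⟨fun x => by_contra fun y => (h.1 l R t).2 y x,
      fun x => by_contra fun y => (h.1 l R t).1 y x⟩, fun i j => (h.2 i j).symm⟩
  | succ k ih =>
    refine ⟨ih h.1, fun i => ⟨fun b hb => ?_, fun a ha => ?_⟩⟩
    · obtain ⟨a, ha, hs⟩ := (h.2 i).2 b hb
      exact ⟨a, ha, ih hs⟩
    · obtain ⟨b, hb, hs⟩ := (h.2 i).1 a ha
      exact ⟨b, hb, ih hs⟩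

/-- An element at distance at most `s` can be added at the cost of `s` rounds. -/
theorem forth {k s : ℕ} {ι : Type} {α : ι → A} {β : ι → B} (h : Sim (k + s) α β) {i : ι} {a : A}
    (ha : A.Near s (α i) a) : ∃ b, B.Near s (β i) b ∧ Sim k (optCons a α) (optCons b β) := by
  induction s generalizing k a with
  | zero =>
    obtain rfl := near_zero.1 ha
    exact ⟨β i, Near.refl _ _, Sim.reindex' h (fun o : Option ι => o.elim i id)
      (by rintro (_ | _) <;> rfl) (by rintro (_ | _) <;> rfl)⟩
  | succ s ih =>
    obtain ⟨c, hc, hca⟩ := near_succ.1 ha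
    obtain ⟨d, hd, hs⟩ := ih (k := k + 1) (h.mono (by omega)) hc
    obtain ⟨b, hb, hs'⟩ := (hs.2 none).1 a hca
    refine ⟨b, near_succ.2 ⟨d, hd, hb⟩, hs'.reindex' (Option.map some) ?_ ?_⟩ <;>
      rintro (_ | _) <;> rfl

/-- The point `α j` is reached from `α i` by `r` moves; since equalities are preserved, the
answering point must be `β j`. -/
theorem near {k r : ℕ} (hr : r ≤ k) {ι : Type} {α : ι → A} {β : ι → B} (h : Sim k α β) {i j : ι}
    (hij : A.Near r (α i) (α j)) : B.Near r (β i) (β j) := by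
  obtain ⟨b, hb, hs⟩ := (h.mono hr : Sim r α β).mono (le_of_eq (Nat.zero_add r)) |>.forth hij
  have : b = β j := (hs.zero.2 none (some j)).1 rfl
  exact this ▸ hb

theorem extend_fin {k s q : ℕ} {ι : Type} {α : ι → A} {β : ι → B}
    (h : Sim (k + q * s) α β) (c : Fin q → A) (f : Fin q → ι)
    (hc : ∀ x, A.Near s (α (f x)) (c x)) :
    ∃ d : Fin q → B, (∀ x, B.Near s (β (f x)) (d x)) ∧ Sim k (Sum.elim α c) (Sum.elim β d) := by
  induction q generalizing k with
  | zero =>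
    refine ⟨Fin.elim0, fun x => x.elim0, Sim.reindex' (h.mono (by omega))
      (fun x => x.elim id Fin.elim0) ?_ ?_⟩ <;> rintro (x | x) <;> first | rfl | exact x.elim0
  | succ q ih =>
    obtain ⟨d, hd, hs⟩ := ih (k := k + s) (h.mono (by grind)) (fun x => c x.castSucc)
      (fun x => f x.castSucc) (fun x => hc _)
    obtain ⟨b, hb, hs'⟩ := hs.forth (i := .inl (f (Fin.last q))) (hc (Fin.last q))
    refine ⟨Fin.snoc d b, fun x => ?_, hs'.reindex' (Sum.elim (fun i => some (.inl i))
      (Fin.snoc (α := fun _ => Option (ι ⊕ Fin q)) (fun x => some (.inr x)) none)) ?_ ?_⟩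
    · induction x using Fin.lastCases with
      | last => simpa using hb
      | cast x => simpa using hd x
    · rintro (x | x)
      · rfl
      · induction x using Fin.lastCases <;> simp
    · rintro (x | x)
      · rfl
      · induction x using Fin.lastCases <;> simp

/-- Elements at distance at most `s` can be added at the cost of `s` rounds each. -/
theorem extend {k s : ℕ} {ι κ : Type} [Finite κ] {α : ι → A} {β : ι → B}
    (h : Sim (k + Nat.card κ * s) α β) (c : κ → A) (f : κ → ι)
    (hc : ∀ x, A.Near s (α (f x)) (c x)) :
    ∃ d : κ → B, (∀ x, B.Near s (β (f x)) (d x)) ∧ Sim k (Sum.elim α c) (Sum.elim β d) := by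
  let e := Finite.equivFin κ
  obtain ⟨d, hd, hs⟩ := extend_fin h (c ∘ e.symm) (f ∘ e.symm) (fun x => hc _)
  refine ⟨d ∘ e, fun x => by simpa using hd (e x), hs.reindex' (Sum.map id e) ?_ ?_⟩ <;>
    rintro (x | x) <;> simp

theorem extend_back {k s : ℕ} {ι κ : Type} [Finite κ] {α : ι → A} {β : ι → B}
    (h : Sim (k + Nat.card κ * s) α β) (d : κ → B) (f : κ → ι)
    (hd : ∀ x, B.Near s (β (f x)) (d x)) :
    ∃ c : κ → A, (∀ x, A.Near s (α (f x)) (c x)) ∧ Sim k (Sum.elim α c) (Sum.elim β d) := by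
  obtain ⟨c, hc, hs⟩ := Sim.extend (A := B.dual) (B := A.dual) h.dual d f hd
  exact ⟨c, hc, hs.of_dual⟩

/-- Families split into far apart parts are related if the parts are. -/
theorem amalgam {k : ℕ} {ι κ : Type} [Nonempty κ] (cl : ι → κ) {α : ι → A} {β : ι → B}
    (h : ∀ c, Sim k (fun x : {i // cl i = c} => α x) (fun x => β x))
    (hα : ∀ i j, A.Near (k + 1) (α i) (α j) → cl i = cl j)
    (hβ : ∀ i j, B.Near (k + 1) (β i) (β j) → cl i = cl j) : Sim k α β := by
  induction k generalizing ι with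
  | zero =>
    -- A positive literal true in `A`, or a negative one false in `B`, sits on a clique, so its
    -- arguments lie in a single part. A nullary literal can be tested in any part, provided there
    -- is one.
    have key : ∀ {l : ℕ} (t : Fin l → ι), (∀ i j, cl (t i) = cl (t j)) →
        ∃ c, ∀ i, cl (t i) = c := by
      intro l t ht
      rcases l with _ | l
      · exact ⟨Classical.arbitrary κ, fun i => i.elim0⟩
      · exact ⟨cl (t 0), fun i => ht i 0⟩
    refine ⟨fun l R t => ⟨fun x => ?_, fun x => ?_⟩, fun i j => ?_⟩
    · obtain ⟨c, hc⟩ := key t fun i j => hα _ _ (near_one.2 (A.pos_clique R _ x i j))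
      exact ((h c).1 l R (fun i => ⟨t i, hc i⟩)).1 x
    · by_contra hx
      obtain ⟨c, hc⟩ := key t fun i j => hβ _ _ (near_one.2 (B.neg_clique R _ hx i j))
      exact hx (((h c).1 l R (fun i => ⟨t i, hc i⟩)).2 x)
    · constructor
      · intro e
        have := hα i j (e ▸ Near.refl _ _)
        exact ((h (cl j)).2 ⟨i, this⟩ ⟨j, rfl⟩).1 e
      · intro e
        have := hβ i j (e ▸ Near.refl _ _)
        exact ((h (cl j)).2 ⟨i, this⟩ ⟨j, rfl⟩).2 e
  | succ k ih =>
    -- A move near `α i` is answered within the part of `i`, which the new elements join. They lie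
    -- within 1 of that part, so the separation drops by one per round.
    have key : ∀ (i : ι) (a : A) (b : B), A.Near 1 (α i) a → B.Near 1 (β i) b →
        Sim k (optCons a (fun x : {j // cl j = cl i} => α x)) (optCons b (fun x => β x)) →
        Sim k (optCons a α) (optCons b β) := by
      intro i a b ha hb hs
      refine ih (optCons (cl i) cl) (fun c => ?_) ?_ ?_
      · by_cases hc : c = cl i
        · subst hc
          refine hs.reindex' (fun x => match x with
            | ⟨none, _⟩ => none
            | ⟨some j, hj⟩ => some ⟨j, hj⟩) ?_ ?_ <;> rintro ⟨_ | j, hj⟩ <;> rfl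
        · refine ((h c).1).reindex' (fun x => match x with
            | ⟨none, hj⟩ => absurd hj.symm hc
            | ⟨some j, hj⟩ => ⟨j, hj⟩) ?_ ?_ <;> rintro ⟨_ | j, hj⟩ <;>
            first | exact absurd hj.symm hc | rfl
      · rintro (_ | i') (_ | j') hn
        · rfl
        · exact hα _ _ (ha.trans' hn (by omega))
        · exact hα _ _ (Near.trans' hn ha.symm (by omega))
        · exact hα _ _ (hn.mono (by omega))
      · rintro (_ | i') (_ | j') hn
        · rfl
        · exact hβ _ _ (hb.trans' hn (by omega))
        · exact hβ _ _ (Near.trans' hn hb.symm (by omega))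
        · exact hβ _ _ (hn.mono (by omega))
    refine ⟨ih cl (fun c => (h c).1) (fun i j hn => hα i j (hn.mono (by omega)))
      (fun i j hn => hβ i j (hn.mono (by omega))), fun i => ⟨fun a ha => ?_, fun b hb => ?_⟩⟩
    · obtain ⟨b, hb, hs⟩ := ((h (cl i)).2 ⟨i, rfl⟩).1 a ha
      exact ⟨b, hb, key i a b ha hb hs⟩
    · obtain ⟨a, ha, hs⟩ := ((h (cl i)).2 ⟨i, rfl⟩).2 b hb
      exact ⟨a, ha, key i a b ha hb hs⟩

/-- Two far apart families that are related separately are related jointly. -/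
theorem sumElim {k : ℕ} {ι κ : Type} {α : ι → A} {β : ι → B} {γ : κ → A} {δ : κ → B}
    (h : Sim k α β) (h' : Sim k γ δ) (hA : ∀ i j, ¬ A.Near (k + 1) (α i) (γ j))
    (hB : ∀ i j, ¬ B.Near (k + 1) (β i) (δ j)) : Sim k (Sum.elim α γ) (Sum.elim β δ) := by
  refine amalgam (κ := Bool) (fun x => x.isLeft) (fun c => ?_) ?_ ?_
  · cases c
    · refine h'.reindex' (fun x => match x with
        | ⟨.inr j, _⟩ => j
        | ⟨.inl _, hj⟩ => nomatch hj) ?_ ?_ <;> rintro ⟨i | j, hj⟩ <;> first | rfl | nomatch hj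
    · refine h.reindex' (fun x => match x with
        | ⟨.inl j, _⟩ => j
        | ⟨.inr _, hj⟩ => nomatch hj) ?_ ?_ <;> rintro ⟨i | j, hj⟩ <;> first | rfl | nomatch hj
  · rintro (i | i) (j | j) hn
    · rfl
    · exact absurd hn (hA i j)
    · exact absurd hn.symm (hA j i)
    · rfl
  · rintro (i | i) (j | j) hn
    · rfl
    · exact absurd hn (hB i j)
    · exact absurd hn.symm (hB j i)
    · rfl

end Sim

/-! ### Evaluation of formulae, and local types -/

/-- Truth of a formula in a structure with independent literals. -/
def LitStructure.Holds (A : LitStructure.{u, v, z} τ) : {n : ℕ} → Formula τ n → (Fin n → A) → Prop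
  | _, .rel R v, a => A.holds (.pos R (a ∘ v))
  | _, .nrel R v, a => A.holds (.neg R (a ∘ v))
  | _, .eq i j, a => a i = a j
  | _, .neq i j, a => a i ≠ a j
  | _, .and φ ψ, a => A.Holds φ a ∧ A.Holds ψ a
  | _, .or φ ψ, a => A.Holds φ a ∨ A.Holds ψ a
  | _, .ex φ, a => ∃ b : A, A.Holds φ (Fin.snoc a b)
  | _, .all φ, a => ∀ b : A, A.Holds φ (Fin.snoc a b)
  | _, .bex r i φ, a => ∃ b : A, A.Near r (a i) b ∧ A.Holds φ (Fin.snoc a b)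
  | _, .ball r i φ, a => ∀ b : A, A.Near r (a i) b → A.Holds φ (Fin.snoc a b)

theorem Formula.LocalFrom.shift {r c n : ℕ} {δ δ' : Fin n → ℕ} {φ : Formula τ n}
    (h : φ.LocalFrom r δ) (hδ : ∀ i, δ' i ≤ δ i + c) : φ.LocalFrom (r + c) δ' := by
  induction φ with
  | rel | nrel | eq | neq => trivial
  | and φ ψ hφ hψ => exact ⟨hφ h.1 hδ, hψ h.2 hδ⟩
  | or φ ψ hφ hψ => exact ⟨hφ h.1 hδ, hψ h.2 hδ⟩
  | ex | all => exact h
  | bex s i φ ih | ball s i φ ih =>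
    refine ⟨by have := h.1; have := hδ i; omega, ih h.2 fun j => ?_⟩
    induction j using Fin.lastCases with
    | last => have := hδ i; simp only [Fin.snoc_last]; omega
    | cast j => simpa using hδ j

theorem Formula.exists_conj {r n : ℕ} {δ : Fin (n + 1) → ℕ} {S : Set (Formula τ (n + 1))}
    (hS : S.Finite) (hloc : ∀ φ ∈ S, φ.LocalFrom r δ) :
    ∃ χ : Formula τ (n + 1), χ.LocalFrom r δ ∧
      ∀ (A : LitStructure.{u, v, z} τ) (a : Fin (n + 1) → A),
        A.Holds χ a ↔ ∀ φ ∈ S, A.Holds φ a := by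
  induction S, hS using Set.Finite.induction_on with
  | empty => exact ⟨.eq 0 0, trivial, fun A a => by simp [Holds]⟩
  | @insert φ S _ _ ih =>
    obtain ⟨χ, hχ, h⟩ := ih fun φ hφ => hloc φ (Set.mem_insert_of_mem _ hφ)
    exact ⟨.and φ χ, ⟨hloc φ (Set.mem_insert _ _), hχ⟩, fun A a => by simp [Holds, h]⟩

theorem Formula.exists_disj {r n : ℕ} {δ : Fin (n + 1) → ℕ} {S : Set (Formula τ (n + 1))}
    (hS : S.Finite) (hloc : ∀ φ ∈ S, φ.LocalFrom r δ) :
    ∃ χ : Formula τ (n + 1), χ.LocalFrom r δ ∧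
      ∀ (A : LitStructure.{u, v, z} τ) (a : Fin (n + 1) → A),
        A.Holds χ a ↔ ∃ φ ∈ S, A.Holds φ a := by
  induction S, hS using Set.Finite.induction_on with
  | empty => exact ⟨.neq 0 0, trivial, fun A a => by simp [Holds]⟩
  | @insert φ S _ _ ih =>
    obtain ⟨χ, hχ, h⟩ := ih fun φ hφ => hloc φ (Set.mem_insert_of_mem _ hφ)
    exact ⟨.or φ χ, ⟨hloc φ (Set.mem_insert _ _), hχ⟩, fun A a => by simp [Holds, h]⟩

theorem optCons_snoc {X : Type*} {n : ℕ} (a : X) (α : Fin n → X) (o : Option (Fin n)) :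
    optCons a α o = (Fin.snoc α a : Fin (n + 1) → X) (o.elim (Fin.last n) Fin.castSucc) := by
  cases o <;> simp

theorem finite_literals (τ : FirstOrder.Language.{u, v}) [Finite τ.Symbols] (n : ℕ) :
    Finite (Σ p : (Σ l, τ.Relations l), (Fin p.1 → Fin n)) := by
  have : Finite (Σ l, τ.Relations l) :=
    Finite.of_injective (β := τ.Symbols) (fun p => Sum.inr p) Sum.inr_injective
  infer_instance

/-- The relation `Sim k` is controlled by finitely many `k`-local formulae. -/
theorem exists_finite_local (τ : FirstOrder.Language.{u, v}) [Finite τ.Symbols] (k n : ℕ) :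
    ∃ Φ : Set (Formula τ n), Φ.Finite ∧ (∀ φ ∈ Φ, φ.IsLocal k) ∧
      ∀ (A B : LitStructure.{u, v, z} τ) (α : Fin n → A) (β : Fin n → B),
        (∀ φ ∈ Φ, A.Holds φ α → B.Holds φ β) → Sim k α β := by
  induction k generalizing n with
  | zero =>
    have := finite_literals τ n
    refine ⟨Set.range (fun p : (Σ p : (Σ l, τ.Relations l), (Fin p.1 → Fin n)) =>
          Formula.rel p.1.2 p.2) ∪
        Set.range (fun p : (Σ p : (Σ l, τ.Relations l), (Fin p.1 → Fin n)) =>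
          Formula.nrel p.1.2 p.2) ∪
        Set.range (fun p : Fin n × Fin n => Formula.eq p.1 p.2) ∪
        Set.range (fun p : Fin n × Fin n => Formula.neq p.1 p.2),
      (((Set.finite_range _).union (Set.finite_range _)).union (Set.finite_range _)).union
        (Set.finite_range _), ?_, fun A B α β h => ⟨fun l R t => ⟨?_, ?_⟩, fun i j => ⟨?_, ?_⟩⟩⟩
    · rintro φ (((⟨p, rfl⟩ | ⟨p, rfl⟩) | ⟨p, rfl⟩) | ⟨p, rfl⟩) <;> trivial
    · exact h _ (Or.inl (Or.inl (Or.inl ⟨⟨⟨l, R⟩, t⟩, rfl⟩)))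
    · exact h _ (Or.inl (Or.inl (Or.inr ⟨⟨⟨l, R⟩, t⟩, rfl⟩)))
    · exact h _ (Or.inl (Or.inr ⟨(i, j), rfl⟩))
    · exact fun e => by_contra fun e' => h _ (Or.inr ⟨(i, j), rfl⟩) e' e
  | succ k ih =>
    obtain ⟨Φ, hΦ, hloc, hsim⟩ := ih n
    obtain ⟨Φ', hΦ', hloc', hsim'⟩ := ih (n + 1)
    have hc : ∀ S ∈ 𝒫 Φ', _ := fun S hS => Formula.exists_conj.{u, v, z} (hΦ'.subset hS)
      (fun φ hφ => hloc' φ (hS hφ))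
    have hd : ∀ S ∈ 𝒫 Φ', _ := fun S hS => Formula.exists_disj.{u, v, z} (hΦ'.subset hS)
      (fun φ hφ => hloc' φ (hS hφ))
    have : Nonempty (Formula τ (n + 1)) := ⟨.eq 0 0⟩
    choose! c hc1 hc2 using hc
    choose! d hd1 hd2 using hd
    -- Forth moves are expressed by the conjunction of the formulae true at `a`, back moves by the
    -- disjunction of those false at `b`. Which formulae occur depends on the structures, hence all
    -- subsets of `Φ'`.
    refine ⟨Φ ∪ Set.image2 (fun i S => .bex 1 i (c S)) Set.univ (𝒫 Φ') ∪
      Set.image2 (fun i S => .ball 1 i (d S)) Set.univ (𝒫 Φ'),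
      (hΦ.union (Set.finite_univ.image2 _ hΦ'.finite_subsets)).union
        (Set.finite_univ.image2 _ hΦ'.finite_subsets), ?_, fun A B α β h => ?_⟩
    · rintro φ ((hφ | ⟨i, -, S, hS, rfl⟩) | ⟨i, -, S, hS, rfl⟩)
      · exact (hloc φ hφ).shift (by simp)
      · refine ⟨by simp, (hc1 S hS).shift fun j => ?_⟩
        induction j using Fin.lastCases <;> simp
      · refine ⟨by simp, (hd1 S hS).shift fun j => ?_⟩
        induction j using Fin.lastCases <;> simp
    · refine ⟨hsim A B α β fun φ hφ => h φ (Or.inl (Or.inl hφ)), fun i => ⟨fun a ha => ?_,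
        fun b hb => ?_⟩⟩
      · have hS : {φ ∈ Φ' | A.Holds φ (Fin.snoc α a)} ∈ 𝒫 Φ' := fun φ hφ => hφ.1
        obtain ⟨b, hb, hh⟩ := h _ (Or.inl (Or.inr ⟨i, trivial, _, hS, rfl⟩))
          ⟨a, ha, (hc2 _ hS _ _).2 fun φ hφ => hφ.2⟩
        have := hsim' A B _ _ fun φ hφ hφ' => (hc2 _ hS _ _).1 hh φ ⟨hφ, hφ'⟩
        exact ⟨b, hb, this.reindex' _ (optCons_snoc a α) (optCons_snoc b β)⟩
      -- By contraposition: the ball formula fails in `B` because of `b`, so it fails in `A` because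
      -- of some `a` at which all formulae false at `b` are false.
      · have hS : {φ ∈ Φ' | ¬ B.Holds φ (Fin.snoc β b)} ∈ 𝒫 Φ' := fun φ hφ => hφ.1
        have := mt (h _ (Or.inr ⟨i, trivial, _, hS, rfl⟩)) fun hh => by
          obtain ⟨φ, hφ, hφ'⟩ := (hd2 _ hS _ _).1 (hh b hb)
          exact hφ.2 hφ'
        simp only [Holds, not_forall] at this
        obtain ⟨a, ha, hh⟩ := this
        have := hsim' A B (Fin.snoc α a) (Fin.snoc β b) fun φ hφ hφ' => by
          by_contra hx
          exact hh ((hd2 _ hS _ _).2 ⟨φ, ⟨hφ, hx⟩, hφ'⟩)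
        exact ⟨a, ha, this.reindex' _ (optCons_snoc a α) (optCons_snoc b β)⟩

/-- Up to `Sim k`, there are only finitely many families with a fixed finite index type. -/
theorem exists_type (τ : FirstOrder.Language.{u, v}) [Finite τ.Symbols] (k : ℕ) (ι : Type)
    [Finite ι] :
    ∃ (N : ℕ) (ty : ∀ A : LitStructure.{u, v, z} τ, (ι → A) → Fin N),
      ∀ (A B : LitStructure.{u, v, z} τ) (α : ι → A) (β : ι → B), ty A α = ty B β → Sim k α β := by
  obtain ⟨n, ⟨e⟩⟩ := Finite.exists_equiv_fin ι
  obtain ⟨Φ, hΦ, -, hsim⟩ := exists_finite_local.{u, v, z} τ k n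
  have := hΦ.to_subtype
  let f := Finite.equivFin (Set Φ)
  refine ⟨_, fun A α => f {φ | A.Holds φ.1 (α ∘ e.symm)}, fun A B α β h => ?_⟩
  have h' := f.injective h
  refine (hsim A B (α ∘ e.symm) (β ∘ e.symm) fun φ hφ hA => ?_).reindex' e (by simp) (by simp)
  have : (⟨φ, hφ⟩ : Φ) ∈ {φ : Φ | A.Holds φ.1 (α ∘ e.symm)} := hA
  rw [h'] at this
  exact this

/-! ### Gaps between distances and scattered families -/

/-- Finitely many thresholds leave out some interval `(t, f t]` with `t` bounded in advance. -/
theorem exists_gap (f : ℕ → ℕ) (hf : ∀ t, t ≤ f t) (c t₀ : ℕ) :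
    ∃ T, ∀ (κ : Type) [Finite κ], Nat.card κ ≤ c → ∀ P : κ → ℕ → Prop,
      (∀ x s t, s ≤ t → P x s → P x t) → ∃ t, t₀ ≤ t ∧ t ≤ T ∧ ∀ x, P x (f t) → P x t := by
  -- Induct on the number of predicates still false at `t₀`: if `t₀` is not a gap, passing to `f t₀`
  -- makes one more of them true.
  suffices h : ∃ T, ∀ (κ : Type) [Finite κ] (P : κ → ℕ → Prop), {x | ¬ P x t₀}.ncard ≤ c →
      (∀ x s t, s ≤ t → P x s → P x t) → ∃ t, t₀ ≤ t ∧ t ≤ T ∧ ∀ x, P x (f t) → P x t by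
    obtain ⟨T, hT⟩ := h
    exact ⟨T, fun κ _ hκ P => hT κ P ((Set.ncard_le_card _).trans hκ)⟩
  induction c generalizing t₀ with
  | zero =>
    refine ⟨t₀, fun κ _ P hc _ => ⟨t₀, le_rfl, le_rfl, fun x _ => ?_⟩⟩
    by_contra hx
    have := (Set.ncard_eq_zero (Set.toFinite _)).1 (Nat.le_zero.1 hc)
    exact Set.notMem_empty x (this ▸ hx)
  | succ c ih =>
    obtain ⟨T, hT⟩ := ih (f t₀)
    refine ⟨max t₀ T, fun κ _ P hc hP => ?_⟩
    by_cases h : ∀ x, P x (f t₀) → P x t₀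
    · exact ⟨t₀, le_rfl, le_max_left _ _, h⟩
    · push Not at h
      obtain ⟨x, hx, hx'⟩ := h
      have hlt : {x | ¬ P x (f t₀)}.ncard < {x | ¬ P x t₀}.ncard :=
        Set.ncard_lt_ncard ⟨fun y hy hy' => hy (hP _ _ _ (hf _) hy'), fun hs => hs hx' hx⟩
          (Set.toFinite _)
      obtain ⟨t, ht, htT, hgap⟩ := hT κ P (by omega) hP
      exact ⟨t, (hf _).trans ht, htT.trans (le_max_right _ _), hgap⟩

/-- A set contains `N` scattered elements, or it is covered by `N` balls. -/
theorem scattered_or_cover (D : Set B) (ρ N : ℕ) :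
    (∃ w : Fin N → B, (∀ i, w i ∈ D) ∧ ∀ i j, B.Near ρ (w i) (w j) → i = j) ∨
      ∃ w : Fin N → B, ∀ x ∈ D, ∃ i, B.Near ρ (w i) x := by
  induction N with
  | zero => exact Or.inl ⟨Fin.elim0, fun i => i.elim0, fun i => i.elim0⟩
  | succ N ih =>
    rcases ih with ⟨w, hw, hs⟩ | ⟨w, hw⟩
    · by_cases h : ∀ x ∈ D, ∃ i, B.Near ρ (w i) x
      · refine Or.inr ⟨Fin.snoc w (Classical.arbitrary B), fun x hx => ?_⟩
        obtain ⟨i, hi⟩ := h x hx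
        exact ⟨i.castSucc, by simpa using hi⟩
      · push Not at h
        obtain ⟨x, hx, hfar⟩ := h
        refine Or.inl ⟨Fin.snoc w x, fun i => ?_, fun i j hij => ?_⟩
        · induction i using Fin.lastCases with
          | last => simpa using hx
          | cast i => simpa using hw i
        · induction i using Fin.lastCases with
          | last =>
            induction j using Fin.lastCases with
            | last => rfl
            | cast j => simp only [Fin.snoc_last, Fin.snoc_castSucc] at hij
                        exact absurd hij.symm (hfar j)
          | cast i =>
            induction j using Fin.lastCases with
            | last => simp only [Fin.snoc_last, Fin.snoc_castSucc] at hij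
                      exact absurd hij (hfar i)
            | cast j => simp only [Fin.snoc_castSucc] at hij
                        rw [hs i j hij]
    · refine Or.inr ⟨Fin.snoc w (Classical.arbitrary B), fun x hx => ?_⟩
      obtain ⟨i, hi⟩ := hw x hx
      exact ⟨i.castSucc, by simpa using hi⟩

/-- Among sufficiently many scattered elements, one is far from all given points. -/
theorem exists_far {E P : Type} [Finite P] [Finite E] (hE : Nat.card P < Nat.card E) {ρ ρ' : ℕ}
    (hρ : 2 * ρ' ≤ ρ) (w : E → A) (hw : ∀ i j, A.Near ρ (w i) (w j) → i = j) (p : P → A) :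
    ∃ e, ∀ x, ¬ A.Near ρ' (w e) (p x) := by
  by_contra h
  push Not at h
  choose f hf using h
  have hinj : Function.Injective f := fun i j hij =>
    hw i j ((hf i).trans' (hij ▸ (hf j).symm) (by omega))
  exact absurd (Nat.card_le_card_of_injective f hinj) (by omega)

/-! ### Rematching -/

/-- The elements reached by alternating paths of the relations `F` and `G` that start outside of
the domain of `G`. -/
inductive AltReach {ι κ : Type} (F G : ι → κ → Prop) : ι → Prop
  | start {i : ι} {j : κ} (h : F i j) (h' : ∀ j, ¬ G i j) : AltReach F G i
  | step {i i' : ι} {j : κ} (h : AltReach F G i) (hF : F i j) (hG : G i' j) : AltReach F G i'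

/-- If `α` is mirrored by `α₀` and `β` is mirrored by `β'`, then `α` can be mirrored by `γ` so that
each element of `β` is close to `γ` unless its mirror image is far from `α`. -/
theorem exists_rematch {ι κ : Type} [Finite ι] {α : ι → A} {α₀ : ι → B} {β' : κ → A} {β : κ → B}
    {K k t F : ℕ} (hα : Sim K α α₀) (hβ : Sim K β' β) (hK : k + Nat.card ι * t ≤ K)
    (hK' : 2 * t ≤ K) (hF : 3 * t ≤ F) (hF' : k + 1 + t ≤ F)
    (gap : ∀ i i', A.Near F (α i) (α i') → A.Near t (α i) (α i'))
    (gap₁ : ∀ i j, A.Near F (α i) (β' j) → A.Near t (α i) (β' j))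
    (gap₂ : ∀ i j, B.Near F (α₀ i) (β j) → B.Near t (α₀ i) (β j)) :
    ∃ γ : ι → B, Sim k α γ ∧ (∀ i j, α i = β' j → α₀ i = β j → γ i = α₀ i) ∧
      ∀ j, (∃ i, B.Near (3 * t) (β j) (γ i)) ∨ ∀ i, ¬ A.Near F (β' j) (α i) := by
  classical
  set f : ι → κ → Prop := fun i j => B.Near t (α₀ i) (β j) with hf
  set g : ι → κ → Prop := fun i j => A.Near t (α i) (β' j) with hg
  have gsat : ∀ {i i' j}, A.Near t (α i) (α i') → g i j → g i' j := fun h h' =>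
    gap₁ _ _ (h.symm.trans' h' (by omega))
  have fsat : ∀ {i i' j}, A.Near t (α i) (α i') → f i j → f i' j := fun h h' =>
    gap₂ _ _ ((hα.near (by omega) h).symm.trans' h' (by omega))
  have Xsat : ∀ {i i'}, A.Near t (α i) (α i') → AltReach f g i → AltReach f g i' := by
    intro i i' h hX
    cases hX with
    | start h₁ h₂ => exact .start (fsat h h₁) fun j hj => h₂ j (gsat h.symm hj)
    | step h₁ h₂ h₃ => exact .step h₁ h₂ (gsat h h₃)
  -- Points near some `β' j` that no alternating path reaches are rerouted along `β' ↦ β`; all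
  -- others keep their image under `α₀`.
  set m : ι → Prop := fun i => ¬ AltReach f g i ∧ ∃ j, g i j with hm
  have msat : ∀ {i i'}, A.Near t (α i) (α i') → m i → m i' := fun h h' =>
    ⟨fun hX => h'.1 (Xsat h.symm hX), h'.2.imp fun j hj => gsat h hj⟩
  choose b hb using fun i : {i // m i} => i.2.2
  obtain ⟨d, hd, hs⟩ := (hβ.mono (k := k + Nat.card {i // m i} * t) (le_trans (by
    have := Nat.mul_le_mul_right t (Finite.card_subtype_le m); omega) hK)).extend
    (fun i : {i // m i} => α i) b (fun i => (hb i).symm)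
  -- If a rerouted image were close to a kept one, then `α₀ i'` would be close to `β (b i)`. Either
  -- `i'` is reached, and then so is `i`, or `i'` could start a path and would be reached after all.
  have mixed : ∀ (i : {i // m i}) (i' : ι), ¬ m i' → ¬ B.Near (k + 1) (d i) (α₀ i') := by
    intro i i' hi' hn
    have hfi : f i' (b i) := gap₂ _ _ (hn.symm.trans' (hd i).symm hF')
    by_cases hX : AltReach f g i'
    · exact i.2.1 (hX.step hfi (hb i))
    · exact hX (.start hfi fun j hj => hi' ⟨hX, j, hj⟩)
  have hγm : ∀ i (h : m i), (if h : m i then d ⟨i, h⟩ else α₀ i) = d ⟨i, h⟩ :=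
    fun i h => dif_pos h
  have hγn : ∀ i (h : ¬ m i), (if h : m i then d ⟨i, h⟩ else α₀ i) = α₀ i := fun i h => dif_neg h
  refine ⟨fun i => if h : m i then d ⟨i, h⟩ else α₀ i, ?_, fun i j h₁ h₂ => ?_, fun j => ?_⟩
  · refine Sim.amalgam m (fun c => ?_) (fun i i' hn => ?_) (fun i i' hn => ?_)
    · by_cases hc : c
      · refine hs.reindex' (fun x => .inr ⟨x.1, x.2.symm ▸ hc⟩) (fun x => rfl) (fun x => ?_)
        exact hγm _ _
      · refine (hα.mono (by omega)).reindex' (fun x => x.1) (fun x => rfl) (fun x => ?_)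
        exact hγn _ (x.2.symm ▸ hc)
    · have := gap i i' (hn.mono (by omega))
      exact propext ⟨msat this, msat this.symm⟩
    · by_cases hi : m i <;> by_cases hi' : m i'
      · exact propext (iff_of_true hi hi')
      · rw [hγm i hi, hγn i' hi'] at hn
        exact absurd hn (mixed _ _ hi')
      · rw [hγn i hi, hγm i' hi'] at hn
        exact absurd hn.symm (mixed _ _ hi)
      · exact propext (iff_of_false hi hi')
  · by_cases hi : m i
    · simp only [hγm i hi]
      exact ((hs.zero.2 (.inr ⟨i, hi⟩) (.inl j)).1 h₁).trans h₂.symm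
    · exact hγn i hi
  · by_cases hj : ∃ i, g i j
    · left
      obtain ⟨i, hi⟩ := hj
      by_cases hX : AltReach f g i
      -- A reached point near `β' j` cannot be a start, so it has a predecessor on its path. That
      -- one is reached too, hence keeps its image, which is near `β j₀` and so near `β j`.
      · obtain ⟨i₀, h₀, h₁⟩ : ∃ i₀, AltReach f g i₀ ∧ B.Near (3 * t) (β j) (α₀ i₀) := by
          cases hX with
          | start _ h => exact absurd hi (h j)
          | @step i₀ _ j₀ h₀ hF₀ hG =>
            have : B.Near (2 * t) (β j) (β j₀) :=
              hβ.near hK' (hi.symm.trans' hG (by omega))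
            exact ⟨i₀, h₀, this.trans' hF₀.symm (by omega)⟩
        exact ⟨i₀, by simpa only [hγn i₀ fun h => h.1 h₀] using h₁⟩
      · have hmi : m i := ⟨hX, j, hi⟩
        refine ⟨i, ?_⟩
        simp only [hγm i hmi]
        have : B.Near (2 * t) (β j) (β (b ⟨i, hmi⟩)) :=
          hβ.near hK' (hi.symm.trans' (hb ⟨i, hmi⟩) (by omega))
        exact this.trans' (hd _) (by omega)
    · right
      intro i hn
      exact hj ⟨i, gap₁ _ _ hn.symm⟩

/-! ### Transfer of universal extensions -/

/-- If all elements of `B` which are rare up to local similarity are covered by a family `β` with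
mirror image `β'` in `A`, and `γ` is close to those elements of `β` whose mirror images are not far
from `α`, then all families in `B` can be mirrored in `A` over `α` and `γ`. -/
theorem exists_mirror {ι κ μ : Type} [Finite ι] [Finite μ] {α : ι → A} {γ : ι → B} {β' : κ → A}
    {β : κ → B} {k r U ρ c T F : ℕ} (hU : r ≤ U)
    (hT : ρ + c + U ≤ T) (hρ : 2 * (U + k + 1) ≤ ρ) (hF : T + 2 * U + ρ + k + 1 ≤ F)
    (hα : Sim (k + Nat.card μ * (T + U)) α γ) (hβ : Sim (k + Nat.card μ * (ρ + U)) β' β)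
    (hcov : ∀ j, (∃ i, B.Near c (β j) (γ i)) ∨ ∀ i, ¬ A.Near F (β' j) (α i)) (y : μ → B)
    (gap : ∀ x i, B.Near (2 * r + k + 1) (y x) (γ i) → B.Near r (y x) (γ i))
    (gap' : ∀ x x', B.Near (2 * r + k + 1) (y x) (y x') → B.Near r (y x) (y x'))
    (hrare : ∀ x, (∃ j, B.Near ρ (β j) (y x)) ∨
      ∃ (N : ℕ) (w : Fin N → A), Nat.card (ι ⊕ μ) < N ∧
        (∀ e, Sim (k + Nat.card μ * U) (fun _ : Unit => w e) (fun _ => y x)) ∧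
        ∀ e e', A.Near ρ (w e) (w e') → e = e') :
    ∃ x : μ → A, Sim k (Sum.elim α x) (Sum.elim γ y) := by
  classical
  -- At the gap scale `r`, the family `y` splits into classes that are far apart. Those near `γ`
  -- (`P₁`) are mirrored over `α`, those near a `β j` with `β' j` far from `α` (`P₂`) over `β'`, and
  -- the others around scattered elements of `A`.
  have htrans : ∀ {a b c}, B.Near r (y a) (y b) → B.Near r (y b) (y c) → B.Near r (y a) (y c) :=
    fun h h' => gap' _ _ (h.trans' h' (by omega))
  set P₁ : μ → Prop := fun x => ∃ x', B.Near r (y x) (y x') ∧ ∃ i, B.Near T (y x') (γ i) with hP₁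
  set P₂ : μ → Prop := fun x => ¬ P₁ x ∧ ∃ x', B.Near r (y x) (y x') ∧
    ∃ j, B.Near ρ (β j) (y x') ∧ ∀ i, ¬ A.Near F (β' j) (α i) with hP₂
  have sat₁ : ∀ {x x'}, B.Near r (y x) (y x') → P₁ x → P₁ x' := by
    rintro x x' h ⟨x'', h', h''⟩
    exact ⟨x'', htrans h.symm h', h''⟩
  have sat₂ : ∀ {x x'}, B.Near r (y x) (y x') → P₂ x → P₂ x' := by
    rintro x x' h ⟨h₁, x'', h', h''⟩
    exact ⟨fun h₂ => h₁ (sat₁ h.symm h₂), x'', htrans h.symm h', h''⟩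
  have hγ₁ : ∀ x i, B.Near (k + 1) (y x) (γ i) → P₁ x := fun x i h =>
    ⟨x, Near.refl _ _, i, (gap x i (h.mono (by omega))).mono (by omega)⟩
  choose p₁ hp₁ i₁ hi₁ using fun x : {x // P₁ x} => x.2
  choose p₂ hp₂ j₂ hj₂ hj₂' using fun x : {x // P₂ x} => x.2.2
  have hc₁ := Nat.mul_le_mul_right (T + U) (Finite.card_subtype_le P₁)
  have hc₂ := Nat.mul_le_mul_right (ρ + U) (Finite.card_subtype_le P₂)
  obtain ⟨x₁, hx₁, hs₁⟩ := (hα.mono (k := k + Nat.card {x // P₁ x} * (T + U))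
    (by omega)).extend_back (fun x : {x // P₁ x} => y x) i₁
    (fun x => (hi₁ x).symm.trans' (hp₁ x).symm (by omega))
  obtain ⟨x₂, hx₂, hs₂⟩ := (hβ.mono (k := k + Nat.card {x // P₂ x} * (ρ + U))
    (by omega)).extend_back (fun x : {x // P₂ x} => y x) j₂
    (fun x => (hj₂ x).trans' (hp₂ x).symm (by omega))
  -- the elements close to `γ` or to the uncovered part of `β`
  have start : ∃ x : μ → A, Sim k (Sum.elim α fun i : {i // P₁ i ∨ P₂ i} => x i)
      (Sum.elim γ fun i => y i) := by
    refine ⟨fun i => if h : P₁ i then x₁ ⟨i, h⟩ else if h' : P₂ i then x₂ ⟨i, h'⟩ else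
      Classical.arbitrary A, ?_⟩
    have := hs₁.sumElim (hs₂.reindex (fun x : {x // P₂ x} => .inr x)) ?_ ?_
    · refine this.reindex' (Sum.elim (fun i => .inl (.inl i)) fun i : {i // P₁ i ∨ P₂ i} =>
        if h : P₁ i then .inl (.inr ⟨i, h⟩) else .inr ⟨i, i.2.resolve_left h⟩) ?_ ?_
      · rintro (i | ⟨i, hi⟩)
        · rfl
        · by_cases h : P₁ i
          · simp [h]
          · simp [h, hi.resolve_left h]
      · rintro (i | ⟨i, hi⟩)
        · rfl
        · by_cases h : P₁ i <;> simp [h]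
    -- `x₂ j` is within `ρ + U` of a point further than `F` from `α`, and `x₁ i` is within `T + U`
    -- of `α`; the size of `F` keeps them more than `k + 1` apart.
    · rintro (i | i) j hn
      · exact hj₂' j i ((hx₂ j).trans' hn.symm (by omega))
      · exact hj₂' j (i₁ i) (((hx₂ j).trans' hn.symm le_rfl).trans' (hx₁ i).symm (by omega))
    · rintro (i | i) j hn
      · exact j.2.1 (hγ₁ j i hn.symm)
      · exact j.2.1 (sat₁ (gap' i j (hn.mono (by omega))) i.2)
  -- the remaining elements are added class by class
  suffices h : ∀ P : Set μ, (∀ i, P₁ i ∨ P₂ i → i ∈ P) →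
      (∀ i j, B.Near r (y i) (y j) → i ∈ P → j ∈ P) →
      (∃ x : μ → A, Sim k (Sum.elim α fun i : P => x i) (Sum.elim γ fun i => y i)) →
      ∃ x : μ → A, Sim k (Sum.elim α x) (Sum.elim γ y) from
    h {i | P₁ i ∨ P₂ i} (fun i hi => hi) (fun i j hij hi => hi.imp (sat₁ hij) (sat₂ hij)) start
  intro P
  induction P using WellFoundedGT.induction with
  | ind P ih =>
    rintro hP hsat ⟨x, hx⟩
    by_cases hall : ∀ i, i ∈ P
    · exact ⟨x, hx.reindex' (Sum.map id fun i => ⟨i, hall i⟩) (by rintro (_ | _) <;> rfl)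
        (by rintro (_ | _) <;> rfl)⟩
    push Not at hall
    obtain ⟨i₀, hi₀⟩ := hall
    -- A missing class avoids the `ρ`-balls around `β`: if `β j` is close to `γ` the class would lie
    -- in `P₁`, and otherwise in `P₁` or `P₂`.
    have hnot : ∀ j, ¬ B.Near ρ (β j) (y i₀) := by
      intro j hj
      rcases hcov j with ⟨i, hi⟩ | hfar
      · exact hi₀ (hP i₀ (Or.inl ⟨i₀, Near.refl _ _, i, hj.symm.trans' hi (by omega)⟩))
      · by_cases h₁ : P₁ i₀
        · exact hi₀ (hP _ (Or.inl h₁))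
        · exact hi₀ (hP _ (Or.inr ⟨h₁, i₀, Near.refl _ _, j, hj, hfar⟩))
    obtain ⟨N, w, hN, hw, hscat⟩ := (hrare i₀).resolve_left fun ⟨j, hj⟩ => hnot j hj
    -- Each point already placed blocks at most one scattered candidate, and there are fewer such
    -- points than candidates.
    obtain ⟨e, he⟩ := exists_far (by simpa using hN) hρ w hscat (Sum.elim α x)
    have hc₃ := Nat.mul_le_mul_right U (Finite.card_subtype_le fun i => B.Near r (y i₀) (y i))
    obtain ⟨x', hx', hs'⟩ := ((hw e).mono (k := k + Nat.card {i // B.Near r (y i₀) (y i)} * U)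
      (by omega)).extend_back (fun i : {i // B.Near r (y i₀) (y i)} => y i) (fun _ => ())
      (fun i => i.2.mono hU)
    have hdisj : ∀ i ∈ P, ¬ B.Near r (y i₀) (y i) := fun i hi hn => hi₀ (hsat _ _ hn.symm hi)
    refine ih (P ∪ {i | B.Near r (y i₀) (y i)}) ?_ (fun i hi => Or.inl (hP i hi)) ?_ ?_
    · exact ⟨Set.subset_union_left, fun h => hi₀ (h (Or.inr (Near.refl _ _)))⟩
    · rintro i j hij (hi | hi)
      · exact Or.inl (hsat i j hij hi)
      · exact Or.inr (htrans hi hij)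
    · refine ⟨fun i => if h : B.Near r (y i₀) (y i) then x' ⟨i, h⟩ else x i, ?_⟩
      have := hx.sumElim (hs'.reindex (fun i : {i // B.Near r (y i₀) (y i)} => .inr i)) ?_ ?_
      · refine this.reindex' (Sum.elim (fun i => .inl (.inl i))
          fun i : ↥(P ∪ {i | B.Near r (y i₀) (y i)}) => if h : B.Near r (y i₀) (y i) then .inr ⟨i, h⟩ else
            .inl (.inr ⟨i, i.2.resolve_right h⟩)) ?_ ?_
        · rintro (i | ⟨i, hi⟩)
          · rfl
          · by_cases h : B.Near r (y i₀) (y i) <;> simp [h]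
        · rintro (i | ⟨i, hi⟩)
          · rfl
          · by_cases h : B.Near r (y i₀) (y i) <;> simp [h]
      · rintro (i | i) j hn
        · exact he (.inl i) ((hx' j).trans' hn.symm (by omega))
        · exact he (.inr i) ((hx' j).trans' hn.symm (by omega))
      · rintro (i | i) j hn
        · refine hi₀ (hsat j i₀ j.2.symm (hP j (Or.inl (hγ₁ j i hn.symm))))
        · exact hdisj i i.2 (htrans j.2 (gap' j i (hn.symm.mono (by omega))))

/-- Finite families over `α` in `A` can be mirrored over `β` in `B`. -/
def ExSim (M K : ℕ) {ι : Type} (α : ι → A) (β : ι → B) : Prop :=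
  ∀ (κ : Type) [Finite κ], Nat.card κ ≤ M → ∀ x : κ → A, ∃ y : κ → B,
    Sim K (Sum.elim α x) (Sum.elim β y)

/-- Finite families over `β` in `B` can be mirrored over `α` in `A`. -/
def AllSim (M K : ℕ) {ι : Type} (α : ι → A) (β : ι → B) : Prop :=
  ∀ (κ : Type) [Finite κ], Nat.card κ ≤ M → ∀ y : κ → B, ∃ x : κ → A,
    Sim K (Sum.elim α x) (Sum.elim β y)

/-- A local type is rare in `B` if `N` balls cover its realisations. Centres of such balls, and
scattered samples for the other types, are mirrored in `A` by `AllSim`; the image of `x` given by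
`ExSim` is then rematched with them, so that every later `y'` can be answered. -/
theorem exists_allSim_transfer (τ : FirstOrder.Language.{u, v}) [Finite τ.Symbols] (k : ℕ)
    (ν π μ : Type) [Finite ν] [Finite π] [Finite μ] :
    ∃ M K, ∀ (A B : LitStructure.{u, v, z} τ) (α : ν → A) (β : ν → B), ExSim M K α β →
      AllSim M K α β → ∀ x : π → A, ∃ y : π → B, ∀ y' : μ → B, ∃ x' : μ → A,
        Sim k (Sum.elim (Sum.elim α x) x') (Sum.elim (Sum.elim β y) y') := by
  obtain ⟨U, hU⟩ := exists_gap (fun t => 2 * t + k + 1) (fun t => by omega)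
    (Nat.card (μ × (ν ⊕ π) ⊕ μ × μ)) 0
  obtain ⟨L, ty, hty⟩ := exists_type.{u, v, z} τ (k + Nat.card μ * U) Unit
  -- With this radius, a point is within `U + k + 1` of at most one scattered element.
  set ρ := 2 * (U + k + 1) with hρ
  set N := Nat.card ((ν ⊕ π) ⊕ μ) + 1 with hN
  -- The gap scale `t` depends on the structures, but is at most `V`, so the remaining constants are
  -- functions of `t`. The term `3 * t` is the closeness achieved by rematching.
  set T : ℕ → ℕ := fun t => ρ + 3 * t + U with hT
  set k' : ℕ → ℕ := fun t => k + Nat.card μ * (T t + U) with hk'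
  set F : ℕ → ℕ := fun t => 3 * t + (k' t + 1 + t) + (T t + 2 * U + ρ + k + 1) with hF
  obtain ⟨V, hV⟩ := exists_gap F (fun t => by simp only [hF]; omega)
    (Nat.card ((ν ⊕ π) × (ν ⊕ π) ⊕ (ν ⊕ π) × (ν ⊕ Fin L × Fin N) ⊕
      (ν ⊕ π) × (ν ⊕ Fin L × Fin N))) 0
  refine ⟨Nat.card π + L * N, k' V + Nat.card (ν ⊕ π) * V + 2 * V + k +
    Nat.card μ * (ρ + U) + ρ + Nat.card μ * U, ?_⟩
  intro A B α β hex hall x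
  obtain ⟨x₀, hx₀⟩ := hex π (by omega) x
  have hw : ∀ s : Fin L, ∃ w : Fin N → B,
      ((∀ i, ∃ b, ty B (fun _ => b) = s ∧
        Sim (k + Nat.card μ * U) (fun _ : Unit => w i) (fun _ => b)) ∧
        ∀ i j, B.Near ρ (w i) (w j) → i = j) ∨
      ∀ b, ty B (fun _ => b) = s → ∃ i, B.Near ρ (w i) b := by
    intro s
    rcases scattered_or_cover {w : B | ∃ b, ty B (fun _ => b) = s ∧
        Sim (k + Nat.card μ * U) (fun _ : Unit => w) (fun _ => b)} ρ N with ⟨w, h, h'⟩ | ⟨w, h⟩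
    · exact ⟨w, Or.inl ⟨h, h'⟩⟩
    · exact ⟨w, Or.inr fun b hb => h b ⟨b, hb, Sim.refl _ _⟩⟩
  choose w hw using hw
  obtain ⟨w', hw'⟩ := hall (Fin L × Fin N) (by simp) (fun p => w p.1 p.2)
  obtain ⟨t, -, htV, ht⟩ := hV _ le_rfl (fun p n => match p with
      | .inl p => A.Near n (Sum.elim α x p.1) (Sum.elim α x p.2)
      | .inr (.inl p) => A.Near n (Sum.elim α x p.1) (Sum.elim α w' p.2)
      | .inr (.inr p) => B.Near n (Sum.elim β x₀ p.1) (Sum.elim β (fun p => w p.1 p.2) p.2))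
    (by rintro (_ | _ | _) s t hst h <;> exact h.mono hst)
  have hk'V : k' t ≤ k' V := by
    simp only [hk', hT]
    gcongr
  have hmulV : Nat.card (ν ⊕ π) * t ≤ Nat.card (ν ⊕ π) * V := Nat.mul_le_mul_left _ htV
  obtain ⟨γ, hγ, hfix, hcov⟩ := exists_rematch (k := k' t) (F := F t) hx₀ hw'
    (by omega) (by omega) (by simp only [hF]; omega) (by simp only [hF]; omega)
    (fun i i' => ht (.inl (i, i'))) (fun i j => ht (.inr (.inl (i, j))))
    (fun i j => ht (.inr (.inr (i, j))))
  -- The parameters belong to both mirrored families, so rematching fixes them.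
  have hγν : ∀ i, γ (.inl i) = β i := fun i => hfix (.inl i) (.inl i) rfl rfl
  have hγe : γ = Sum.elim β (fun i => γ (.inr i)) := by
    funext i
    rcases i with i | i
    · exact hγν i
    · rfl
  refine ⟨fun i => γ (.inr i), fun y' => ?_⟩
  rw [← hγe]
  obtain ⟨r, -, hrU, hr⟩ := hU _ le_rfl (fun p n => match p with
      | .inl p => B.Near n (y' p.1) (γ p.2)
      | .inr p => B.Near n (y' p.1) (y' p.2))
    (by rintro (_ | _) s t hst h <;> exact h.mono hst)
  refine exists_mirror (c := 3 * t) (T := T t) (F := F t) (ρ := ρ) hrU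
    le_rfl le_rfl (by simp only [hF]; omega) hγ (hw'.mono (by omega)) hcov y'
    (fun i j => hr (.inl (i, j))) (fun i j => hr (.inr (i, j))) fun i => ?_
  rcases hw (ty B fun _ => y' i) with ⟨h, h'⟩ | h
  · right
    refine ⟨N, fun e => w' (ty B (fun _ => y' i), e), by omega, fun e => ?_, fun e e' hn => ?_⟩
    · obtain ⟨b, hb, hs⟩ := h e
      exact ((hw'.reindex' (fun _ : Unit => .inr (_, e)) (fun _ => rfl)
        (fun _ => rfl)).mono (by omega)).trans (hs.trans (hty _ _ _ _ hb))
    · exact h' e e' (hw'.near (i := .inr (_, e)) (j := .inr (_, e')) (by omega) hn)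
  · left
    obtain ⟨e, he⟩ := h _ rfl
    exact ⟨.inr (_, e), he⟩

/-! ### Preservation of first-order formulae -/

theorem ExSim.mono {M M' K K' : ℕ} (hM : M ≤ M') (hK : K ≤ K') {ι : Type} {α : ι → A} {β : ι → B}
    (h : ExSim M' K' α β) : ExSim M K α β := fun κ _ hκ x =>
  (h κ (hκ.trans hM) x).imp fun _ hy => hy.mono hK

theorem AllSim.mono {M M' K K' : ℕ} (hM : M ≤ M') (hK : K ≤ K') {ι : Type} {α : ι → A} {β : ι → B}
    (h : AllSim M' K' α β) : AllSim M K α β := fun κ _ hκ x =>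
  (h κ (hκ.trans hM) x).imp fun _ hy => hy.mono hK

theorem ExSim.dual {M K : ℕ} {ι : Type} {α : ι → A} {β : ι → B} (h : ExSim M K α β) :
    AllSim (A := B.dual) (B := A.dual) M K β α := fun κ _ hκ x =>
  (h κ hκ x).imp fun _ hy => hy.dual

theorem AllSim.dual {M K : ℕ} {ι : Type} {α : ι → A} {β : ι → B} (h : AllSim M K α β) :
    ExSim (A := B.dual) (B := A.dual) M K β α := fun κ _ hκ x =>
  (h κ hκ x).imp fun _ hy => hy.dual

theorem ExSim.of_dual {M K : ℕ} {ι : Type} {α : ι → A} {β : ι → B}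
    (h : ExSim (A := B.dual) (B := A.dual) M K β α) : AllSim M K α β := fun κ _ hκ x =>
  (h κ hκ x).imp fun _ hy => hy.of_dual

theorem AllSim.of_dual {M K : ℕ} {ι : Type} {α : ι → A} {β : ι → B}
    (h : AllSim (A := B.dual) (B := A.dual) M K β α) : ExSim M K α β := fun κ _ hκ x =>
  (h κ hκ x).imp fun _ hy => hy.of_dual

theorem ExSim.sim {M K : ℕ} {ι : Type} {α : ι → A} {β : ι → B} (h : ExSim M K α β) :
    Sim K α β := by
  obtain ⟨y, hy⟩ := h Empty (by simp) (fun x => x.elim)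
  exact hy.reindex' .inl (fun _ => rfl) (fun _ => rfl)

/-- Pads families to length exactly `m`, so that a single index type suffices for counting types. -/
theorem exists_comp_fin {κ : Type} [Finite κ] {X : Type*} [Nonempty X] {m : ℕ}
    (hκ : Nat.card κ ≤ m) (x : κ → X) : ∃ (e : κ → Fin m) (x' : Fin m → X), ∀ i, x i = x' (e i) := by
  have hinj : Function.Injective fun i => Fin.castLE hκ (Finite.equivFin κ i) :=
    (Fin.castLE_injective hκ).comp (Finite.equivFin κ).injective
  exact ⟨_, Function.extend _ x fun _ => Classical.arbitrary X,
    fun i => (hinj.extend_apply x _ i).symm⟩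

/-- The transfer is applied to `a` together with one representative of each type of `m`-tuples over
`α` and `a`. The images of the representatives give `ExSim`; the freely chosen second family gives
`AllSim`. -/
theorem exists_forth (τ : FirstOrder.Language.{u, v}) [Finite τ.Symbols] (m k n : ℕ) :
    ∃ M K, ∀ (A B : LitStructure.{u, v, z} τ) (α : Fin n → A) (β : Fin n → B), ExSim M K α β →
      AllSim M K α β → ∀ a : A, ∃ b : B,
        ExSim m k (Fin.snoc α a : Fin (n + 1) → A) (Fin.snoc β b : Fin (n + 1) → B) ∧
        AllSim m k (Fin.snoc α a : Fin (n + 1) → A) (Fin.snoc β b : Fin (n + 1) → B) := by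
  obtain ⟨L, ty, hty⟩ := exists_type.{u, v, z} τ k (Fin (n + 1) ⊕ Fin m)
  obtain ⟨M, K, h⟩ := exists_allSim_transfer.{u, v, z} τ k (Fin n) (Unit ⊕ Fin L × Fin m) (Fin m)
  refine ⟨M, K, fun A B α β hex hall a => ?_⟩
  have hrep : ∀ s, ∃ x : Fin m → A,
      (∃ x', ty A (Sum.elim (Fin.snoc α a : Fin (n + 1) → A) x') = s) →
        ty A (Sum.elim (Fin.snoc α a : Fin (n + 1) → A) x) = s := by
    intro s
    by_cases hs : ∃ x', ty A (Sum.elim (Fin.snoc α a : Fin (n + 1) → A) x') = s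
    · exact hs.imp fun x hx _ => hx
    · exact ⟨fun _ => a, fun h => absurd h hs⟩
  choose x hx using hrep
  obtain ⟨y, hy⟩ := h A B α β hex hall (Sum.elim (fun _ => a) fun p => x p.1 p.2)
  refine ⟨y (.inl ()), fun κ _ hκ u => ?_, fun κ _ hκ u => ?_⟩
  · obtain ⟨e, u', hu⟩ := exists_comp_fin hκ u
    set s := ty A (Sum.elim (Fin.snoc α a : Fin (n + 1) → A) u') with hs
    obtain ⟨x', hx'⟩ := hy fun _ => y (.inl ())
    refine ⟨fun i => y (.inr (s, e i)), ?_⟩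
    have h₁ := hty A A _ _ (hx s ⟨u', rfl⟩).symm
    have h₂ : Sim k (Sum.elim (Fin.snoc α a : Fin (n + 1) → A) (x s))
        (Sum.elim (Fin.snoc β (y (.inl ())) : Fin (n + 1) → B) fun i => y (.inr (s, i))) := by
      refine hx'.reindex' (Sum.elim
        (Fin.snoc (α := fun _ => (Fin n ⊕ (Unit ⊕ Fin L × Fin m)) ⊕ Fin m)
          (fun i => .inl (.inl i)) (.inl (.inr (.inl ()))))
        fun i => .inl (.inr (.inr (s, i)))) ?_ ?_ <;>
      · rintro (i | i)
        · induction i using Fin.lastCases <;> simp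
        · rfl
    exact (h₁.trans h₂).reindex' (Sum.map id e) (by rintro (i | i) <;> simp [hu])
      (by rintro (i | i) <;> simp)
  · obtain ⟨e, u', hu⟩ := exists_comp_fin hκ u
    obtain ⟨x', hx'⟩ := hy u'
    refine ⟨fun i => x' (e i), hx'.reindex' (Sum.elim
        (Fin.snoc (α := fun _ => (Fin n ⊕ (Unit ⊕ Fin L × Fin m)) ⊕ Fin m)
          (fun i => .inl (.inl i)) (.inl (.inr (.inl ()))))
        fun i => .inr (e i)) ?_ ?_⟩ <;>
      · rintro (i | i)
        · induction i using Fin.lastCases <;> simp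
        · simp [hu]

theorem exists_preserved [Finite τ.Symbols] {n : ℕ} (φ : Formula τ n) (hφ : φ.IsFO) :
    ∃ M K, ∀ (A B : LitStructure.{u, v, z} τ) (α : Fin n → A) (β : Fin n → B), ExSim M K α β →
      AllSim M K α β → A.Holds φ α → B.Holds φ β := by
  induction φ with
  | rel R t => exact ⟨0, 0, fun A B α β h _ => (h.sim.zero.1 _ R t).1⟩
  | nrel R t => exact ⟨0, 0, fun A B α β h _ => (h.sim.zero.1 _ R t).2⟩
  | eq i j => exact ⟨0, 0, fun A B α β h _ => (h.sim.zero.2 i j).1⟩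
  | neq i j => exact ⟨0, 0, fun A B α β h _ => mt (h.sim.zero.2 i j).2⟩
  | and φ ψ ihφ ihψ =>
    obtain ⟨M, K, h⟩ := ihφ hφ.1
    obtain ⟨M', K', h'⟩ := ihψ hφ.2
    exact ⟨max M M', max K K', fun A B α β h₁ h₂ => And.imp
      (h A B α β (h₁.mono (le_max_left _ _) (le_max_left _ _))
        (h₂.mono (le_max_left _ _) (le_max_left _ _)))
      (h' A B α β (h₁.mono (le_max_right _ _) (le_max_right _ _))
        (h₂.mono (le_max_right _ _) (le_max_right _ _)))⟩
  | or φ ψ ihφ ihψ =>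
    obtain ⟨M, K, h⟩ := ihφ hφ.1
    obtain ⟨M', K', h'⟩ := ihψ hφ.2
    exact ⟨max M M', max K K', fun A B α β h₁ h₂ => Or.imp
      (h A B α β (h₁.mono (le_max_left _ _) (le_max_left _ _))
        (h₂.mono (le_max_left _ _) (le_max_left _ _)))
      (h' A B α β (h₁.mono (le_max_right _ _) (le_max_right _ _))
        (h₂.mono (le_max_right _ _) (le_max_right _ _)))⟩
  | ex φ ih =>
    obtain ⟨m, k, h⟩ := ih hφ
    obtain ⟨M, K, h'⟩ := exists_forth.{u, v, z} τ m k _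
    refine ⟨M, K, fun A B α β h₁ h₂ => ?_⟩
    rintro ⟨a, ha⟩
    obtain ⟨b, hb₁, hb₂⟩ := h' A B α β h₁ h₂ a
    exact ⟨b, h A B _ _ hb₁ hb₂ ha⟩
  | all φ ih =>
    obtain ⟨m, k, h⟩ := ih hφ
    obtain ⟨M, K, h'⟩ := exists_forth.{u, v, z} τ m k _
    refine ⟨M, K, fun A B α β h₁ h₂ ha b => ?_⟩
    -- A universal quantifier from `A` to `B` is a forth move from `B.dual` to `A.dual`.
    obtain ⟨a, ha₁, ha₂⟩ := h' B.dual A.dual β α h₂.dual h₁.dual b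
    exact h A B _ _ ha₂.of_dual ha₁.of_dual (ha a)
  | bex | ball => exact hφ.elim

/-! ### Scattered families -/

/-- Scattered families in `A` can be replaced by scattered families in `B`, each of whose elements
is related to some element of the former. -/
def ScatSim (N R : ℕ) (A B : LitStructure.{u, v, z} τ) : Prop :=
  ∀ r ≤ R, ∀ q ≤ N, ∀ c : Fin q → A, (∀ i j, A.Near (2 * r) (c i) (c j) → i = j) →
    ∃ b : Fin q → B, (∀ i j, B.Near (2 * r) (b i) (b j) → i = j) ∧
      ∀ i, ∃ j, Sim r (fun _ : Unit => c j) (fun _ => b i)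

/-- Scattered families can be mirrored elementwise. -/
theorem ScatSim.exists_sdr {Q : Type} [Finite Q] {N R r U k : ℕ} (h : ScatSim N R A B)
    (hQ : Nat.card Q ≤ N) (hr : r ≤ R) (hU : U ≤ 2 * r)
    (hgap : ∀ (κ : Type) [Finite κ], Nat.card κ ≤ (2 ^ N * N) * (2 ^ N * N) →
      ∀ P : κ → ℕ → Prop, (∀ x s t, s ≤ t → P x s → P x t) →
        ∃ t, 0 ≤ t ∧ t ≤ U ∧ ∀ x, P x (2 * t + k) → P x t)
    (c : Q → A) (hc : ∀ i j, A.Near (2 * r) (c i) (c j) → i = j) :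
    ∃ d : Q → B, (∀ i j, B.Near k (d i) (d j) → i = j) ∧
      ∀ i, Sim r (fun _ : Unit => c i) (fun _ => d i) := by
  classical
  have := Fintype.ofFinite Q
  rw [Nat.card_eq_fintype_card] at hQ
  -- Prepare Hall's theorem: every `J` gets its own scattered family in `B`, and the points of all
  -- these families will be grouped into clusters at a gap scale.
  have hJ : ∀ J : Finset Q, ∃ b : J → B, (∀ i j, B.Near (2 * r) (b i) (b j) → i = j) ∧
      ∀ i, ∃ j : J, Sim r (fun _ : Unit => c j) (fun _ => b i) := by
    intro J
    obtain ⟨b, hb, hb'⟩ := h r hr J.card ((Finset.card_le_univ J).trans hQ)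
      (fun i => c (J.equivFin.symm i)) fun i j hij =>
        J.equivFin.symm.injective (Subtype.ext (hc _ _ hij))
    refine ⟨fun i => b (J.equivFin i), fun i j hij => J.equivFin.injective (hb _ _ hij),
      fun i => ?_⟩
    obtain ⟨j, hj⟩ := hb' (J.equivFin i)
    exact ⟨_, hj⟩
  choose b hb hb' using hJ
  set κ := Σ J : Finset Q, {x // x ∈ J} with hκ
  set p : κ → B := fun x => b x.1 x.2 with hp
  have hcard : Nat.card κ ≤ 2 ^ N * N := by
    have hinj : Function.Injective fun x : κ => (x.1, x.2.1) := by
      rintro ⟨J, x⟩ ⟨J', x'⟩ hx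
      simp only [Prod.mk.injEq] at hx
      obtain ⟨rfl, hx⟩ := hx
      rw [Subtype.ext hx]
    refine (Nat.card_le_card_of_injective _ hinj).trans ?_
    rw [Nat.card_prod, Nat.card_eq_fintype_card, Nat.card_eq_fintype_card, Fintype.card_finset]
    exact Nat.mul_le_mul (Nat.pow_le_pow_right (by norm_num) hQ) hQ
  obtain ⟨t, -, htU, ht⟩ := hgap (κ × κ) (by rw [Nat.card_prod]; exact Nat.mul_le_mul hcard hcard)
    (fun x s => B.Near s (p x.1) (p x.2)) fun x s t hst hx => hx.mono hst
  let S : Setoid κ := ⟨fun x y => B.Near t (p x) (p y), fun x => Near.refl _ _, fun h => h.symm,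
    fun {x y z} h h' => ht (x, z) (h.trans' h' (by omega))⟩
  have hsound : ∀ x y : κ, B.Near (2 * t + k) (p x) (p y) → Quotient.mk S x = Quotient.mk S y :=
    fun x y hxy => Quotient.sound (ht (x, y) hxy)
  have := Fintype.ofFinite (Quotient S)
  -- Hall's condition holds since the points obtained for `J` are `2 * r`-scattered and `t ≤ 2 * r`:
  -- they lie in distinct clusters, each admissible for a member of `J`.
  obtain ⟨f, hf, hf'⟩ := (Finset.all_card_le_biUnion_card_iff_exists_injective
    fun j : Q => Finset.univ.filter fun q : Quotient S =>
      ∃ x : κ, Quotient.mk S x = q ∧ Sim r (fun _ : Unit => c j) (fun _ => p x)).1 (by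
    intro J
    rw [← Finset.card_attach]
    refine Finset.card_le_card_of_injOn (fun i => Quotient.mk S ⟨J, i⟩) (fun i _ => ?_)
      fun i _ j _ hij => ?_
    · obtain ⟨j, hj⟩ := hb' J i
      simp only [Finset.coe_biUnion, Set.mem_iUnion, Finset.coe_filter, Finset.mem_univ, true_and]
      exact ⟨j, j.2, ⟨J, i⟩, rfl, hj⟩
    · have : B.Near t (p ⟨J, i⟩) (p ⟨J, j⟩) := Quotient.exact hij
      exact hb J i j (this.mono (htU.trans hU)))
  simp only [Finset.mem_filter, Finset.mem_univ, true_and] at hf'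
  choose x hx hx' using hf'
  refine ⟨fun i => p (x i), fun i j hij => hf ?_, hx'⟩
  rw [← hx, ← hx]
  exact hsound _ _ (hij.mono (by omega))

/-- Cluster the family at a gap scale. Representatives of the clusters are scattered, so they can be
mirrored one by one and amalgamated; the rest of each cluster then follows by local moves. -/
theorem exists_scatSim_exSim (τ : FirstOrder.Language.{u, v}) (M K : ℕ) :
    ∃ N R, ∀ (A B : LitStructure.{u, v, z} τ), ScatSim N R A B →
      ∀ (α : Fin 0 → A) (β : Fin 0 → B), ExSim M K α β := by
  suffices h : ∀ N, ∃ R, ∀ (A B : LitStructure.{u, v, z} τ), ScatSim N R A B →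
      ∀ (κ : Type) [Finite κ] [Nonempty κ], Nat.card κ ≤ N → ∀ x : κ → A, ∃ y : κ → B,
        Sim K x y by
    -- A dummy element is added because an empty scattered family carries no information, not even
    -- about nullary literals.
    obtain ⟨R, hR⟩ := h (M + 1)
    refine ⟨M + 1, R, fun A B hAB α β κ _ hκ x => ?_⟩
    obtain ⟨y, hy⟩ := hR A B hAB (Option κ) (by rw [Finite.card_option]; omega)
      (optCons (Classical.arbitrary A) x)
    exact ⟨fun i => y (some i), hy.reindex' (Sum.elim Fin.elim0 some)
      (by rintro (i | i); exacts [i.elim0, rfl]) (by rintro (i | i); exacts [i.elim0, rfl])⟩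
  intro N
  choose U hU using fun t => exists_gap (fun s => 2 * s + (K + N * t + 1)) (fun t => by omega)
    ((2 ^ N * N) * (2 ^ N * N)) 0
  set r : ℕ → ℕ := fun t => U t + (K + N * t + 1) with hr
  obtain ⟨V, hV⟩ := exists_gap (fun t => 2 * t + 2 * r t) (fun t => by omega) (N * N) 0
  -- The sum merely bounds every `r t` with `t ≤ V`.
  refine ⟨∑ t ∈ Finset.range (V + 1), r t, fun A B hAB κ _ _ hκ x => ?_⟩
  obtain ⟨t, -, htV, ht⟩ := hV (κ × κ) (by rw [Nat.card_prod]; exact Nat.mul_le_mul hκ hκ)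
    (fun p s => A.Near s (x p.1) (x p.2)) fun x s t hst hx => hx.mono hst
  let S : Setoid κ := ⟨fun i j => A.Near t (x i) (x j), fun x => Near.refl _ _, fun h => h.symm,
    fun {i j l} h h' => ht (i, l) (h.trans' h' (by omega))⟩
  have hfar : ∀ p q : Quotient S, A.Near (2 * r t) (x p.out) (x q.out) → p = q := by
    intro p q hpq
    rw [← p.out_eq, ← q.out_eq]
    exact Quotient.sound (ht (p.out, q.out) (hpq.mono (by omega)))
  obtain ⟨d, hd, hd'⟩ := hAB.exists_sdr (Q := Quotient S) (r := r t) (U := U t)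
    (k := K + N * t + 1) ((Nat.card_le_card_of_surjective _ Quotient.mk_surjective).trans hκ)
    (Finset.single_le_sum (f := r) (fun _ _ => Nat.zero_le _) (Finset.mem_range.2 (by omega)))
    (by simp only [hr]; omega) (hU t) (fun p => x p.out) hfar
  have : Nonempty (Quotient S) := Nonempty.map (Quotient.mk S) inferInstance
  have hs : Sim (K + N * t) (fun p : Quotient S => x p.out) d := by
    refine Sim.amalgam id (fun p => ?_) (fun p q hpq => hfar p q (hpq.mono ?_)) hd
    · exact ((hd' p).mono (by simp only [hr]; omega)).reindex' (fun _ => ())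
        (fun q => by rw [show q.1 = p from q.2]) (fun q => by rw [show q.1 = p from q.2])
    · simp only [hr]; omega
  obtain ⟨y, -, hy⟩ := (hs.mono (k := K + Nat.card κ * t) (by gcongr)).extend x
    (fun i => Quotient.mk S i) (fun i => Quotient.mk_out (s := S) i)
  exact ⟨y, hy.reindex .inr⟩

/-! ### Local sentences -/

namespace LitStructure

theorem holds_rename {n m : ℕ} (f : Fin n → Fin m) (φ : Formula τ n) (a : Fin m → A) :
    A.Holds (φ.rename f) a ↔ A.Holds φ (a ∘ f) := by
  have key : ∀ {n m : ℕ} (f : Fin n → Fin m) (a : Fin m → A) (b : A),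
      (Fin.snoc a b : Fin (m + 1) → A) ∘
        (Fin.snoc (fun i => (f i).castSucc) (Fin.last m) : Fin (n + 1) → Fin (m + 1)) =
      Fin.snoc (a ∘ f) b := by
    intro n m f a b
    funext i
    induction i using Fin.lastCases <;> simp
  induction φ generalizing m with
  | rel | nrel | eq | neq => rfl
  | and φ ψ hφ hψ => exact and_congr (hφ f a) (hψ f a)
  | or φ ψ hφ hψ => exact or_congr (hφ f a) (hψ f a)
  | ex φ ih => exact exists_congr fun b => (ih _ _).trans (iff_of_eq (congrArg _ (key f a b)))
  | all φ ih => exact forall_congr' fun b => (ih _ _).trans (iff_of_eq (congrArg _ (key f a b)))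
  | bex r i φ ih =>
    exact exists_congr fun b => and_congr Iff.rfl
      ((ih _ _).trans (iff_of_eq (congrArg _ (key f a b))))
  | ball r i φ ih =>
    exact forall_congr' fun b => imp_congr Iff.rfl
      ((ih _ _).trans (iff_of_eq (congrArg _ (key f a b))))

theorem holds_exs {m : ℕ} (φ : Formula τ m) (a : Fin 0 → A) :
    A.Holds φ.exs a ↔ ∃ b : Fin m → A, A.Holds φ b := by
  induction m with
  | zero => exact ⟨fun h => ⟨a, h⟩, fun ⟨b, h⟩ => Subsingleton.elim b a ▸ h⟩
  | succ m ih =>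
    refine (ih _).trans ⟨fun ⟨b, c, h⟩ => ⟨_, h⟩, fun ⟨b, h⟩ => ⟨Fin.init b, b (Fin.last m), ?_⟩⟩
    rwa [Fin.snoc_init_self]

theorem holds_alls {m : ℕ} (φ : Formula τ m) (a : Fin 0 → A) :
    A.Holds φ.alls a ↔ ∀ b : Fin m → A, A.Holds φ b := by
  induction m with
  | zero => exact ⟨fun h b => Subsingleton.elim a b ▸ h, fun h => h a⟩
  | succ m ih =>
    refine (ih _).trans ⟨fun h b => ?_, fun h b c => h _⟩
    have := h (Fin.init b) (b (Fin.last m))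
    rwa [Fin.snoc_init_self] at this

theorem holds_conj {m n : ℕ} (φ : Fin (m + 1) → Formula τ n) (a : Fin n → A) :
    A.Holds (Formula.conj m φ) a ↔ ∀ i, A.Holds (φ i) a := by
  induction m with
  | zero => simp [Formula.conj]
  | succ m ih => rw [Fin.forall_fin_succ, ← ih]; rfl

theorem holds_disj {m n : ℕ} (φ : Fin (m + 1) → Formula τ n) (a : Fin n → A) :
    A.Holds (Formula.disj m φ) a ↔ ∃ i, A.Holds (φ i) a := by
  induction m with
  | zero => simp [Formula.disj]
  | succ m ih => rw [Fin.exists_fin_succ, ← ih]; rfl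

theorem holds_distGT {n r : ℕ} (i j : Fin n) (a : Fin n → A) :
    A.Holds (Formula.distGT r i j) a ↔ ¬ A.Near r (a i) (a j) := by
  simp only [Formula.distGT, Holds, Fin.snoc_last, Fin.snoc_castSucc]
  exact ⟨fun h h' => h _ h' rfl, fun h b hb e => h (e ▸ hb)⟩

theorem holds_distLE {n r : ℕ} (i j : Fin n) (a : Fin n → A) :
    A.Holds (Formula.distLE r i j) a ↔ A.Near r (a i) (a j) := by
  simp only [Formula.distLE, Holds, Fin.snoc_last, Fin.snoc_castSucc]
  exact ⟨fun ⟨b, h, e⟩ => e ▸ h, fun h => ⟨_, h, rfl⟩⟩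

theorem forall_mem_pairs {X : Type*} {m r : ℕ} (P : ℕ → X → X → Prop)
    (hP : ∀ {a b}, P r a b → P r b a) (a : Fin m → X) :
    (∀ p ∈ Formula.pairs m, ¬ P r (a p.1) (a p.2)) ↔ ∀ i j, P r (a i) (a j) → i = j := by
  simp only [Formula.pairs, List.mem_filter, Prod.forall, decide_eq_true_eq]
  constructor
  · intro h i j hij
    rcases lt_trichotomy i j with hlt | heq | hgt
    · exact absurd hij (h i j ⟨List.pair_mem_product.2 ⟨List.mem_finRange _, List.mem_finRange _⟩,
        hlt⟩)
    · exact heq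
    · exact absurd (hP hij) (h j i ⟨List.pair_mem_product.2
        ⟨List.mem_finRange _, List.mem_finRange _⟩, hgt⟩)
  · exact fun h i j hij hn => hij.2.ne (h i j hn)

theorem holds_exScattered {m r : ℕ} (θ : Formula τ m) (a : Fin 0 → A) :
    A.Holds (Formula.exScattered r θ) a ↔
      ∃ b : Fin m → A, (∀ i j, A.Near (2 * r) (b i) (b j) → i = j) ∧ A.Holds θ b := by
  rw [Formula.exScattered, holds_exs]
  refine exists_congr fun b => ?_
  rw [← forall_mem_pairs A.Near Near.symm]
  induction Formula.pairs m with
  | nil => simp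
  | cons p l ih => simp [Holds, ih, holds_distGT, and_assoc]

theorem holds_allScattered {m r : ℕ} (θ : Formula τ m) (a : Fin 0 → A) :
    A.Holds (Formula.allScattered r θ) a ↔
      ∀ b : Fin m → A, (∀ i j, A.Near (2 * r) (b i) (b j) → i = j) → A.Holds θ b := by
  rw [Formula.allScattered, holds_alls]
  refine forall_congr' fun b => ?_
  rw [← forall_mem_pairs A.Near Near.symm]
  induction Formula.pairs m with
  | nil => simp
  | cons p l ih =>
    simp only [List.foldr_cons, Holds, ih, holds_distLE, List.forall_mem_cons, and_imp]
    exact or_iff_not_imp_left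

end LitStructure

/-- Finitely many local formulae describe the elements above the elements of arbitrary sets. -/
theorem exists_local_upper (τ : FirstOrder.Language.{u, v}) [Finite τ.Symbols] (k : ℕ) :
    ∃ Θ : Set (Formula τ 1), Θ.Finite ∧ (∀ θ ∈ Θ, θ.IsLocal k) ∧
      ∀ (A : LitStructure.{u, v, z} τ) (D : Set A), ∃ θ ∈ Θ, (∀ d ∈ D, A.Holds θ fun _ => d) ∧
        ∀ (B : LitStructure.{u, v, z} τ) (b : B), B.Holds θ (fun _ => b) →
          ∃ d ∈ D, Sim k (fun _ : Unit => d) (fun _ => b) := by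
  obtain ⟨Φ, hΦ, hloc, hsim⟩ := exists_finite_local.{u, v, z} τ k 1
  have : Nonempty (Formula τ 1) := ⟨.eq 0 0⟩
  have hc : ∀ S ∈ 𝒫 Φ, _ := fun S hS => Formula.exists_conj.{u, v, z} (hΦ.subset hS)
    (fun φ hφ => hloc φ (hS hφ))
  choose! c hc₁ hc₂ using hc
  have hfin := hΦ.finite_subsets.image c
  have hd : ∀ S ∈ 𝒫 (c '' 𝒫 Φ), _ := fun S hS => Formula.exists_disj.{u, v, z} (hfin.subset hS)
    (fun φ hφ => by obtain ⟨T, hT, rfl⟩ := hS hφ; exact hc₁ T hT)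
  choose! d hd₁ hd₂ using hd
  refine ⟨d '' 𝒫 (c '' 𝒫 Φ), hfin.finite_subsets.image d, ?_, fun A D => ?_⟩
  · rintro _ ⟨S, hS, rfl⟩
    exact hd₁ S hS
  · have hT : ∀ a : A, {φ ∈ Φ | A.Holds φ fun _ => a} ∈ 𝒫 Φ := fun a φ hφ => hφ.1
    -- The formula is the disjunction over `d ∈ D` of the conjunction of everything in `Φ` true at
    -- `d`.
    have hS : (fun a : A => c {φ ∈ Φ | A.Holds φ fun _ => a}) '' D ∈ 𝒫 (c '' 𝒫 Φ) := by
      rintro _ ⟨a, -, rfl⟩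
      exact ⟨_, hT a, rfl⟩
    refine ⟨_, ⟨_, hS, rfl⟩, fun a ha => (hd₂ _ hS _ _).2 ⟨_, ⟨a, ha, rfl⟩,
      (hc₂ _ (hT a) _ _).2 fun φ hφ => hφ.2⟩, fun B b hb => ?_⟩
    obtain ⟨_, ⟨a, ha, rfl⟩, hab⟩ := (hd₂ _ hS _ _).1 hb
    have := hsim A B (fun _ => a) (fun _ => b) fun φ hφ h => (hc₂ _ (hT a) _ _).1 hab φ ⟨hφ, h⟩
    exact ⟨a, ha, this.reindex fun _ => 0⟩

/-- Finitely many local formulae describe the elements not below the elements of arbitrary sets. -/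
theorem exists_local_lower (τ : FirstOrder.Language.{u, v}) [Finite τ.Symbols] (k : ℕ) :
    ∃ Θ : Set (Formula τ 1), Θ.Finite ∧ (∀ θ ∈ Θ, θ.IsLocal k) ∧
      ∀ (A : LitStructure.{u, v, z} τ) (D : Set A), ∃ θ ∈ Θ, (∀ d ∈ D, ¬ A.Holds θ fun _ => d) ∧
        ∀ (B : LitStructure.{u, v, z} τ) (b : B), ¬ B.Holds θ (fun _ => b) →
          ∃ d ∈ D, Sim k (fun _ : Unit => b) (fun _ => d) := by
  obtain ⟨Φ, hΦ, hloc, hsim⟩ := exists_finite_local.{u, v, z} τ k 1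
  have : Nonempty (Formula τ 1) := ⟨.eq 0 0⟩
  have hd : ∀ S ∈ 𝒫 Φ, _ := fun S hS => Formula.exists_disj.{u, v, z} (hΦ.subset hS)
    (fun φ hφ => hloc φ (hS hφ))
  choose! d hd₁ hd₂ using hd
  have hfin := hΦ.finite_subsets.image d
  have hc : ∀ S ∈ 𝒫 (d '' 𝒫 Φ), _ := fun S hS => Formula.exists_conj.{u, v, z} (hfin.subset hS)
    (fun φ hφ => by obtain ⟨T, hT, rfl⟩ := hS hφ; exact hd₁ T hT)
  choose! c hc₁ hc₂ using hc
  refine ⟨c '' 𝒫 (d '' 𝒫 Φ), hfin.finite_subsets.image c, ?_, fun A D => ?_⟩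
  · rintro _ ⟨S, hS, rfl⟩
    exact hc₁ S hS
  · have hT : ∀ a : A, {φ ∈ Φ | ¬ A.Holds φ fun _ => a} ∈ 𝒫 Φ := fun a φ hφ => hφ.1
    have hS : (fun a : A => d {φ ∈ Φ | ¬ A.Holds φ fun _ => a}) '' D ∈ 𝒫 (d '' 𝒫 Φ) := by
      rintro _ ⟨a, -, rfl⟩
      exact ⟨_, hT a, rfl⟩
    refine ⟨_, ⟨_, hS, rfl⟩, fun a ha h => ?_, fun B b hb => ?_⟩
    · obtain ⟨φ, hφ, h'⟩ := (hd₂ _ (hT a) _ _).1 ((hc₂ _ hS _ _).1 h _ ⟨a, ha, rfl⟩)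
      exact hφ.2 h'
    · rw [hc₂ _ hS] at hb
      push Not at hb
      obtain ⟨_, ⟨a, ha, rfl⟩, hab⟩ := hb
      have := hsim B A (fun _ => b) (fun _ => a) fun φ hφ h => by
        by_contra h'
        exact hab ((hd₂ _ (hT a) _ _).2 ⟨φ, ⟨hφ, h'⟩, h⟩)
      exact ⟨a, ha, this.reindex fun _ => 0⟩

/-- One local formula describes lying above some entry of the given family, and a basic local
sentence asserts it of all scattered elements; this is why `ScatSim` does not pair up the entries.
-/
theorem exists_basicLocal_scatSim (τ : FirstOrder.Language.{u, v}) [Finite τ.Symbols] (N R : ℕ) :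
    ∃ Ψ : Set (Sentence τ), Ψ.Finite ∧ (∀ φ ∈ Ψ, φ.IsBasicLocal) ∧
      ∀ A B : LitStructure.{u, v, z} τ, (∀ φ ∈ Ψ, A.Holds φ Fin.elim0 → B.Holds φ Fin.elim0) →
        ScatSim N R A B := by
  choose Θ hfin hloc hΘ using exists_local_upper.{u, v, z} τ
  -- `Formula.conj q` has `q + 1` conjuncts, so `q < N` covers the sizes from 1 to `N`.
  refine ⟨⋃ r ∈ Set.Iic R, ⋃ q ∈ Set.Iio N, (fun θ : Formula τ 1 =>
    Formula.exScattered r (Formula.conj q fun i => θ.rename fun _ => i)) '' Θ r,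
    (Set.finite_Iic R).biUnion fun r _ => (Set.finite_Iio N).biUnion fun q _ => (hfin r).image _,
    ?_, fun A B h r hr q hq c hc => ?_⟩
  · simp only [Set.mem_iUnion]
    rintro _ ⟨r, -, q, -, θ, hθ, rfl⟩
    exact .ex r q θ (hloc r θ hθ)
  · rcases q with _ | q
    · exact ⟨Fin.elim0, fun i => i.elim0, fun i => i.elim0⟩
    obtain ⟨θ, hθ, hθ₁, hθ₂⟩ := hΘ r A (Set.range c)
    have := h (Formula.exScattered r (Formula.conj q fun i => θ.rename fun _ => i))
      (by simp only [Set.mem_iUnion]; exact ⟨r, hr, q, hq, θ, hθ, rfl⟩)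
      ((holds_exScattered _ _).2 ⟨c, hc, (holds_conj _ _).2 fun i =>
        (holds_rename _ _ _).2 (hθ₁ _ ⟨i, rfl⟩)⟩)
    obtain ⟨b, hb, hb'⟩ := (holds_exScattered _ _).1 this
    refine ⟨b, hb, fun i => ?_⟩
    obtain ⟨_, ⟨j, rfl⟩, hj⟩ := hθ₂ B (b i) ((holds_rename _ _ _).1 ((holds_conj _ _).1 hb' i))
    exact ⟨j, hj⟩

/-- By contraposition: a scattered family in `B` refutes a universal sentence, which then fails in
`A`; the counterexample there lies elementwise below the given family. -/
theorem exists_basicLocal_scatSim_dual (τ : FirstOrder.Language.{u, v}) [Finite τ.Symbols]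
    (N R : ℕ) :
    ∃ Ψ : Set (Sentence τ), Ψ.Finite ∧ (∀ φ ∈ Ψ, φ.IsBasicLocal) ∧
      ∀ A B : LitStructure.{u, v, z} τ, (∀ φ ∈ Ψ, A.Holds φ Fin.elim0 → B.Holds φ Fin.elim0) →
        ScatSim N R B.dual A.dual := by
  choose Θ hfin hloc hΘ using exists_local_lower.{u, v, z} τ
  refine ⟨⋃ r ∈ Set.Iic R, ⋃ q ∈ Set.Iio N, (fun θ : Formula τ 1 =>
    Formula.allScattered r (Formula.disj q fun i => θ.rename fun _ => i)) '' Θ r,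
    (Set.finite_Iic R).biUnion fun r _ => (Set.finite_Iio N).biUnion fun q _ => (hfin r).image _,
    ?_, fun A B h r hr q hq c hc => ?_⟩
  · simp only [Set.mem_iUnion]
    rintro _ ⟨r, -, q, -, θ, hθ, rfl⟩
    exact .all r q θ (hloc r θ hθ)
  · rcases q with _ | q
    · exact ⟨Fin.elim0, fun i => i.elim0, fun i => i.elim0⟩
    obtain ⟨θ, hθ, hθ₁, hθ₂⟩ := hΘ r B (Set.range c)
    have := mt (h _ (by simp only [Set.mem_iUnion]; exact ⟨r, hr, q, hq, θ, hθ, rfl⟩)) fun hB => by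
      obtain ⟨i, hi⟩ := (holds_disj _ _).1 ((holds_allScattered _ _).1 hB c hc)
      exact hθ₁ _ ⟨i, rfl⟩ ((holds_rename _ _ _).1 hi)
    rw [holds_allScattered] at this
    push Not at this
    obtain ⟨b, hb, hb'⟩ := this
    refine ⟨b, hb, fun i => ?_⟩
    obtain ⟨_, ⟨j, rfl⟩, hj⟩ := hθ₂ A (b i) fun hi =>
      hb' ((holds_disj _ _).2 ⟨i, (holds_rename _ _ _).2 hi⟩)
    exact ⟨j, hj.dual⟩

/-! ### Assembling the normal form -/

theorem exists_isLocalSentence_conj {S : Set (Sentence τ)} (hS : S.Finite)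
    (hloc : ∀ φ ∈ S, φ.IsLocalSentence) :
    ∃ χ : Sentence τ, χ.IsLocalSentence ∧ ∀ (A : LitStructure.{u, v, z} τ) (a : Fin 0 → A),
      A.Holds χ a ↔ ∀ φ ∈ S, A.Holds φ a := by
  induction S, hS using Set.Finite.induction_on with
  | empty =>
    refine ⟨_, .basic (.ex 0 0 (.eq 0 0) trivial), fun A a => ?_⟩
    simp [holds_exScattered, Formula.conj, holds_rename, Holds, Fin.fin_one_eq_zero]
  | @insert φ S _ _ ih =>
    obtain ⟨χ, hχ, h⟩ := ih fun φ hφ => hloc φ (Set.mem_insert_of_mem _ hφ)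
    exact ⟨.and φ χ, .and (hloc φ (Set.mem_insert _ _)) hχ, fun A a => by simp [Holds, h]⟩

theorem exists_isLocalSentence_disj {S : Set (Sentence τ)} (hS : S.Finite)
    (hloc : ∀ φ ∈ S, φ.IsLocalSentence) :
    ∃ χ : Sentence τ, χ.IsLocalSentence ∧ ∀ (A : LitStructure.{u, v, z} τ) (a : Fin 0 → A),
      A.Holds χ a ↔ ∃ φ ∈ S, A.Holds φ a := by
  induction S, hS using Set.Finite.induction_on with
  | empty =>
    refine ⟨_, .basic (.ex 0 0 (.neq 0 0) trivial), fun A a => ?_⟩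
    simp [holds_exScattered, Formula.conj, holds_rename, Holds]
  | @insert φ S _ _ ih =>
    obtain ⟨χ, hχ, h⟩ := ih fun φ hφ => hloc φ (Set.mem_insert_of_mem _ hφ)
    exact ⟨.or φ χ, .or (hloc φ (Set.mem_insert _ _)) hχ, fun A a => by simp [Holds, h]⟩

/-- Gaifman normal forms for structures with independent literals. -/
theorem exists_isLocalSentence_holds_iff [Finite τ.Symbols] (ψ : Sentence τ) (hψ : ψ.IsFO) :
    ∃ φ : Sentence τ, φ.IsLocalSentence ∧ ∀ (A : LitStructure.{u, v, z} τ) (a : Fin 0 → A),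
      A.Holds ψ a ↔ A.Holds φ a := by
  obtain ⟨M, K, hψ'⟩ := exists_preserved.{u, v, z} ψ hψ
  obtain ⟨N, R, hNR⟩ := exists_scatSim_exSim.{u, v, z} τ M K
  obtain ⟨Ψ₁, hfin₁, hloc₁, h₁⟩ := exists_basicLocal_scatSim.{u, v, z} τ N R
  obtain ⟨Ψ₂, hfin₂, hloc₂, h₂⟩ := exists_basicLocal_scatSim_dual.{u, v, z} τ N R
  set Ψ := Ψ₁ ∪ Ψ₂ with hΨ
  have hfin : Ψ.Finite := hfin₁.union hfin₂
  have hloc : ∀ φ ∈ Ψ, φ.IsLocalSentence := by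
    rintro φ (hφ | hφ)
    exacts [.basic (hloc₁ φ hφ), .basic (hloc₂ φ hφ)]
  have hpres : ∀ A B : LitStructure.{u, v, z} τ,
      (∀ φ ∈ Ψ, A.Holds φ Fin.elim0 → B.Holds φ Fin.elim0) →
      A.Holds ψ Fin.elim0 → B.Holds ψ Fin.elim0 := fun A B h =>
    hψ' A B _ _ (hNR A B (h₁ A B fun φ hφ => h φ (Or.inl hφ)) _ _)
      (hNR B.dual A.dual (h₂ A B fun φ hφ => h φ (Or.inr hφ)) _ _).of_dual
  have : Nonempty (Sentence τ) := ⟨ψ⟩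
  have hc : ∀ S ∈ 𝒫 Ψ, _ := fun S hS => exists_isLocalSentence_conj.{u, v, z} (hfin.subset hS)
    (fun φ hφ => hloc φ (hS hφ))
  choose! c hc₁ hc₂ using hc
  -- The normal form is the disjunction, over all models of `ψ`, of the conjunction of the sentences
  -- of `Ψ` true there; only finitely many subsets of `Ψ` arise.
  set 𝒮 : Set (Set (Sentence τ)) := {S | ∃ A : LitStructure.{u, v, z} τ,
    A.Holds ψ Fin.elim0 ∧ {φ ∈ Ψ | A.Holds φ Fin.elim0} = S} with h𝒮
  have h𝒮Ψ : 𝒮 ⊆ 𝒫 Ψ := by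
    rintro _ ⟨A, -, rfl⟩ φ hφ
    exact hφ.1
  obtain ⟨χ, hχ, h⟩ := exists_isLocalSentence_disj.{u, v, z}
    ((hfin.finite_subsets.subset h𝒮Ψ).image c) (by
      rintro _ ⟨S, hS, rfl⟩
      exact hc₁ S (h𝒮Ψ hS))
  refine ⟨χ, hχ, fun A a => ?_⟩
  obtain rfl : a = Fin.elim0 := Subsingleton.elim _ _
  rw [h]
  constructor
  · intro hA
    have hS : {φ ∈ Ψ | A.Holds φ Fin.elim0} ∈ 𝒮 := ⟨A, hA, rfl⟩
    exact ⟨_, ⟨_, hS, rfl⟩, (hc₂ _ (h𝒮Ψ hS) _ _).2 fun φ hφ => hφ.2⟩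
  · rintro ⟨_, ⟨_, ⟨B, hB, rfl⟩, rfl⟩, hA⟩
    exact hpres B A (fun φ hφ hφB => (hc₂ _ (h𝒮Ψ ⟨B, hB, rfl⟩) _ _).1 hA φ ⟨hφ, hφB⟩) hB

/-! ### Lattice semirings -/

section Prime

variable {X : Type z} {K : Type w} [CommSemiring K]

/-- The structure obtained from an interpretation by a predicate separating `0` from `1`. -/
def LitStructure.ofInterpretation [Nonempty X] (π : Interpretation τ X K) (hπ : π.ModelDefining)
    (hπ' : π.TracksPositive) (p : K → Prop) (h₀ : ¬ p 0) (h₁ : p 1) :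
    LitStructure.{u, v, z} τ where
  carrier := X
  nonempty := inferInstance
  graph := π.gaifmanGraph
  holds l := p (π l)
  pos_clique R a h i j := by
    by_cases hij : a i = a j
    · exact Or.inr hij
    · exact Or.inl ⟨hij, _, R, a, fun h' => h₀ (h' ▸ h), ⟨i, rfl⟩, ⟨j, rfl⟩⟩
  neg_clique R a h i j := by
    by_cases hij : a i = a j
    · exact Or.inr hij
    -- The value 1 would satisfy `p`, so a failing negative literal has value 0; the positive one is
    -- then non-zero and yields an edge.
    · have hneg : π (.neg R a) = 0 := (hπ' _ R a).resolve_right fun h' => h (h' ▸ h₁)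
      refine Or.inl ⟨hij, _, R, a, fun h' => ?_, ⟨i, rfl⟩, ⟨j, rfl⟩⟩
      rcases hπ _ R a with hx | hx
      exacts [hx.2 hneg, hx.2 h']

theorem prime_sum_iff {ι : Type*} {p : K → Prop} (h₀ : ¬ p 0)
    (hadd : ∀ a b, p (a + b) ↔ p a ∨ p b) (s : Finset ι) (f : ι → K) :
    p (∑ i ∈ s, f i) ↔ ∃ i ∈ s, p (f i) := by
  classical
  induction s using Finset.induction_on with
  | empty => simpa using h₀
  | insert i s hi ih => simp [Finset.sum_insert hi, hadd, ih]

theorem prime_prod_iff {ι : Type*} {p : K → Prop} (h₁ : p 1)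
    (hmul : ∀ a b, p (a * b) ↔ p a ∧ p b) (s : Finset ι) (f : ι → K) :
    p (∏ i ∈ s, f i) ↔ ∀ i ∈ s, p (f i) := by
  classical
  induction s using Finset.induction_on with
  | empty => simpa using h₁
  | insert i s hi ih => simp [Finset.prod_insert hi, hmul, ih]

/-- `p` acts as a homomorphism to the truth values, and ball quantifiers agree because the structure
carries the Gaifman graph of `π` itself. -/
theorem LitStructure.holds_ofInterpretation [Fintype X] [Nonempty X] (π : Interpretation τ X K)
    (hπ : π.ModelDefining) (hπ' : π.TracksPositive) {p : K → Prop} (h₀ : ¬ p 0) (h₁ : p 1)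
    (hadd : ∀ a b, p (a + b) ↔ p a ∨ p b) (hmul : ∀ a b, p (a * b) ↔ p a ∧ p b) {n : ℕ}
    (φ : Formula τ n) (a : Fin n → X) :
    p (π.eval φ a) ↔ (ofInterpretation π hπ hπ' p h₀ h₁).Holds φ a := by
  induction φ with
  | rel | nrel => rfl
  | eq i j =>
    simp only [Interpretation.eval]
    split_ifs with h
    exacts [iff_of_true h₁ h, iff_of_false h₀ h]
  | neq i j =>
    simp only [Interpretation.eval]
    split_ifs with h
    exacts [iff_of_false h₀ (not_not.2 h), iff_of_true h₁ h]
  | and φ ψ hφ hψ => exact (hmul _ _).trans (and_congr (hφ a) (hψ a))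
  | or φ ψ hφ hψ => exact (hadd _ _).trans (or_congr (hφ a) (hψ a))
  | ex φ ih =>
    refine (prime_sum_iff h₀ hadd _ _).trans (exists_congr fun b => ?_)
    exact (and_iff_right (Finset.mem_univ b)).trans (ih _)
  | all φ ih =>
    refine (prime_prod_iff h₁ hmul _ _).trans (forall_congr' fun b => ?_)
    exact (forall_prop_of_true (Finset.mem_univ b)).trans (ih _)
  | bex r i φ ih =>
    refine (prime_sum_iff h₀ hadd _ _).trans (exists_congr fun b => and_congr ?_ (ih _))
    simp [Interpretation.nbhd, Near, ofInterpretation]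
  | ball r i φ ih =>
    refine (prime_prod_iff h₁ hmul _ _).trans (forall_congr' fun b => imp_congr ?_ (ih _))
    simp [Interpretation.nbhd, Near, ofInterpretation]

end Prime

/-- The principal filter of `x` and the principal ideal of `y` are disjoint, so the prime ideal
theorem separates them. -/
theorem exists_isPrime_of_not_le {K : Type w} [DistribLattice K] {x y : K} (h : ¬ x ≤ y) :
    ∃ J : Order.Ideal K, J.IsPrime ∧ y ∈ J ∧ x ∉ J := by
  obtain ⟨J, hJ, hy, hx⟩ := DistribLattice.prime_ideal_of_disjoint_filter_ideal
    (F := Order.PFilter.principal x) (I := Order.Ideal.principal y) (by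
      rw [Set.disjoint_left]
      intro z hz hz'
      exact h (le_trans (Order.PFilter.mem_principal.1 hz) (Order.Ideal.mem_principal.1 hz')))
  exact ⟨J, hJ, hy (Order.Ideal.mem_principal.2 le_rfl),
    Set.disjoint_left.1 hx (Order.PFilter.mem_principal.2 le_rfl)⟩

/-- Sentences with the same truth value in all structures with independent literals are
lattice-equivalent. -/
theorem latticeEquiv_of_holds_iff {n : ℕ} {φ ψ : Formula τ n}
    (h : ∀ (A : LitStructure.{u, v, z} τ) (a : Fin n → A), A.Holds φ a ↔ A.Holds ψ a) :
    LatticeEquiv.{u, v, w, z} φ ψ := by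
  intro K _ _ _
  let : CommSemiring K := latticeSemiring K
  intro X _ _ π hπ hπ' a
  have key : ∀ J : Order.Ideal K, J.IsPrime → (π.eval φ a ∉ J ↔ π.eval ψ a ∉ J) := by
    intro J hJ
    have h₀ : ¬ (0 : K) ∉ J := not_not.2 J.bot_mem
    have h₁ : (1 : K) ∉ J := fun h => hJ.toIsProper.ne_univ
      (Set.eq_univ_of_forall fun x => J.lower le_top h)
    have hadd : ∀ x y : K, x + y ∉ J ↔ x ∉ J ∨ y ∉ J := fun x y =>
      (not_congr (Order.Ideal.sup_mem_iff (I := J) (x := x) (y := y))).trans not_and_or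
    have hmul : ∀ x y : K, x * y ∉ J ↔ x ∉ J ∧ y ∉ J := fun x y => by
      rw [← not_or]
      refine not_congr ⟨fun hxy => hJ.mem_or_mem hxy, ?_⟩
      rintro (hx | hy)
      exacts [J.lower inf_le_left hx, J.lower inf_le_right hy]
    exact (holds_ofInterpretation π hπ hπ' (p := fun x => x ∉ J) h₀ h₁ hadd hmul φ a).trans
      ((h (ofInterpretation π hπ hπ' (fun x => x ∉ J) h₀ h₁) a).trans
        (holds_ofInterpretation π hπ hπ' (p := fun x => x ∉ J) h₀ h₁ hadd hmul ψ a).symm)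
  apply le_antisymm <;> by_contra hle <;> obtain ⟨J, hJ, hy, hx⟩ := exists_isPrime_of_not_le hle
  exacts [(key J hJ).1 hx hy, (key J hJ).2 hx hy]

end SemiringLogic

theorem mainTheorem3 (τ : FirstOrder.Language.{u, v}) [τ.IsRelational]
    [Finite τ.Symbols] (ψ : SemiringLogic.Sentence τ) (hψ : ψ.IsFO) :
    ∃ φ : SemiringLogic.Sentence τ,
      φ.IsLocalSentence ∧ SemiringLogic.LatticeEquiv.{u, v, w, z} ψ φ := by
  obtain ⟨φ, hφ, h⟩ := SemiringLogic.exists_isLocalSentence_holds_iff.{u, v, z} ψ hψ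
  exact ⟨φ, hφ, SemiringLogic.latticeEquiv_of_holds_iff h⟩
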